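/- Let $\mathbb{D}=\{z\in\mathbb{C}:|z|<1\}$, $\mathbb{T}=\partial\mathbb{D}$, and let $\mathcal{H}(\mathbb{D})$ be the space of analytic functions in $\mathbb{D}$. Let $H^\infty$ be the space of bounded functions in $\mathcal{H}(\mathbb{D})$ with the norm $\|f\|_{H^\infty}=\sup_{z\in\mathbb{D}}|f(z)|$, and let $A$ be the disc algebra, that is, the space of all $f\in\mathcal{H}(\mathbb{D})$ that extend continuously to $\overline{\mathbb{D}}$, with the same norm. For a finite complex Borel measure $\mu$ on $\mathbb{T}$ with total variation $\|\mu\|$, let $$(K\mu)(z)=\int_{\mathbb{T}}\frac{d\mu(\xi)}{1-\overline{\xi}z},\quad z\in\mathbb{D}.$$ Let $\mathcal{K}$ be the space of all functions $K\mu$, with the norm $\|f\|_{\mathcal{K}}=\inf\{\|\mu\|:f=K\mu\}$, and let $\mathcal{K}_a\subset\mathcal{K}$ be the subspace, with the norm of $\mathcal{K}$, of all $K\mu$ with $\mu$ absolutely continuous with respect to arc length. For $g\in\mathcal{H}(\mathbb{D})$ let $$T_g(f)(z)=\int_0^z f(\zeta)g'(\zeta)\,d\zeta,\quad f\in\mathcal{H}(\mathbb{D}),\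 z\in\mathbb{D},$$ and, for $z,w\in\mathbb{D}$, let $$\overline{G^{H^2}_{g,z}(w)}=\int_0^z g'(\zeta)\overline{K^{H^2}_\zeta(w)}\,d\zeta=\int_0^z\frac{g'(\zeta)}{1-\overline{w}\zeta}\,d\zeta,$$ where $K^{H^2}_\zeta(w)=1/(1-\overline{\zeta}w)$ is the reproducing kernel of the Hardy space $H^2$. **Theorem.** Let $g\in\mathcal{H}(\mathbb{D})$. (i) The following conditions are equivalent: (a) $T_g:H^\infty\to H^\infty$ is bounded; (b) $T_g:A\to H^\infty$ is bounded; (c) $\sup_{z\in\mathbb{D}}\|G^{H^2}_{g,z}\|_{\mathcal{K}}<\infty$. (ii) $T_g:\mathcal{K}_a\to H^\infty$ is bounded if and only if $g$ is constant. -/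

import Mathlib

open MeasureTheory Metric Set
open scoped ENNReal NNReal ComplexConjugate

noncomputable section

/-- The open unit disc `𝔻`. Functions on `𝔻` are represented by functions `ℂ → ℂ`, of which only the
values on `𝔻` enter the norms, the operator and the kernels below. -/
def unitDisc : Set ℂ := ball 0 1

/-- `H(𝔻)`: the analytic functions in the unit disc. -/
def analyticDisc : Set (ℂ → ℂ) := {f | DifferentiableOn ℂ f unitDisc}

/-- `‖f‖_{H^∞} = sup_{z ∈ 𝔻} |f z|`, with value `∞` if `f` is unbounded on `𝔻`. -/
def hInftyNorm (f : ℂ → ℂ) : ℝ≥0∞ := ⨆ z ∈ unitDisc, ‖f z‖ₑ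

/-- `H^∞`: the bounded analytic functions in the unit disc. -/
def hInfty : Set (ℂ → ℂ) := {f | f ∈ analyticDisc ∧ hInftyNorm f < ∞}

/-- The disc algebra `A`: the analytic functions in `𝔻` that extend continuously to the closed
unit disc. It carries the norm of `H^∞`. -/
def discAlgebra : Set (ℂ → ℂ) :=
  {f | f ∈ analyticDisc ∧ ∃ F : ℂ → ℂ, ContinuousOn F (closedBall 0 1) ∧ EqOn f F unitDisc}

/-- The integral operator `T_g f (z) = ∫_0^z f(ζ) g'(ζ) dζ`, the integral being taken along the
segment `ζ = t z`, `0 ≤ t ≤ 1`. -/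
def integralOp (g f : ℂ → ℂ) (z : ℂ) : ℂ :=
  z * ∫ t in (0 : ℝ)..1, f (t * z) * deriv g (t * z)

/-- `T : X → H^∞` is bounded, where `X` is a space of analytic functions in `𝔻` with norm `N`. -/
def BoundedIntoHInfty (X : Set (ℂ → ℂ)) (N : (ℂ → ℂ) → ℝ≥0∞) (T : (ℂ → ℂ) → ℂ → ℂ) : Prop :=
  ∃ C : ℝ≥0, ∀ f ∈ X, T f ∈ hInfty ∧ hInftyNorm (T f) ≤ C * N f

/-- The unit circle `𝕋` carries its Borel `σ`-algebra. -/
instance circleMeasurableSpace : MeasurableSpace Circle := borel Circle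

instance circleBorelSpace : BorelSpace Circle := ⟨rfl⟩

/-- Arc length measure (Lebesgue measure) on the unit circle. -/
def arcLength : Measure Circle :=
  (volume.restrict (Ioc (-Real.pi) Real.pi)).map (fun t : ℝ => Circle.exp t)

/-- The Cauchy transform `Kμ(z) = ∫_𝕋 dμ(ξ) / (1 - conj ξ * z)` of a complex Borel measure on `𝕋`. -/
def cauchyTransform (μ : ComplexMeasure Circle) (z : ℂ) : ℂ :=
  VectorMeasure.integral μ (fun ξ : Circle => 1 / (1 - conj (ξ : ℂ) * z))
    (ContinuousLinearMap.mul ℝ ℂ)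

/-- `‖f‖_𝒦 = inf {‖μ‖ : f = Kμ on 𝔻}`, where `‖μ‖` is the total variation of `μ`. The value is `∞`
if `f` is not a Cauchy transform. -/
def cauchyNorm (f : ℂ → ℂ) : ℝ≥0∞ :=
  ⨅ (μ : ComplexMeasure Circle) (_ : EqOn f (cauchyTransform μ) unitDisc), μ.variation univ

/-- `𝒦_a`: the functions on `𝔻` that are Cauchy transforms of complex measures on `𝕋` which are
absolutely continuous with respect to arc length. It carries the norm of `𝒦`. -/
def cauchyAC : Set (ℂ → ℂ) :=
  {f | ∃ μ : ComplexMeasure Circle,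
    VectorMeasure.AbsolutelyContinuous μ arcLength.toENNRealVectorMeasure ∧
      EqOn f (cauchyTransform μ) unitDisc}

/-- The reproducing kernel of `H^2` at `ζ`, that is `K_ζ(w) = 1 / (1 - conj ζ * w)`. -/
def hardyKernel (ζ w : ℂ) : ℂ := 1 / (1 - conj ζ * w)

/-- The function `G_{g,z}`, determined by `conj (G_{g,z} w) = ∫_0^z g'(ζ) conj (K_ζ w) dζ`, the
integral being taken along the segment `ζ = t z`, `0 ≤ t ≤ 1`. -/
def kernelG (g : ℂ → ℂ) (z w : ℂ) : ℂ :=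
  conj (z * ∫ t in (0 : ℝ)..1, deriv g (t * z) * conj (hardyKernel (t * z) w))

end

/-! Part (i) is a duality. Expanding in powers of `w`, the `n`-th coefficient of `G_{g,z}` is the
conjugate of `T_g(ζ^n)(z)`, while that of `Kμ` is `∫ conj ξ^n dμ`. So `G_{g,z} = Kμ` says that `conj
(T_g f z) = ∫ conj f dμ` on monomials (`conj_integralOp_pow_eq`), hence on every dilate `f(r ·)`,
whose Taylor series converges absolutely on the closed disc (`integralOp_dilation_eq`). This bounds
`T_g f(r ·)` at `z` by `‖μ‖ ‖f‖`, and `r → 1` gives (c) ⇒ (a).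

For (b) ⇒ (c), `u ↦ conj (T_g (conj u) z)` is a bounded functional on the conjugate disc algebra
inside `C(𝕋)`. Hahn-Banach extends it (`exists_extension_integralOp`), the Riesz theorem represents
it by a measure (`ContinuousMap.exists_complexMeasure`), and testing on kernels shows that `G_{g,z}`
is the Cauchy transform of that measure. The Riesz bound loses a factor 6, harmless since only
finiteness is at stake.

For (ii), normalised arc length on shrinking arcs approximates the point mass at `η`, so boundedness
on `𝒦_a` bounds `T_g` of `1/(1 - conj η ζ)` uniformly in `η` and `z` (`norm_integralOp_kernel_le`).
At `z = rη` the integral is radial. Its `k`-th Fourier coefficient in `η` is the `k`-th Taylor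
coefficient of `g'` times `2π ∫ (tr)^k/(1 - tr) dt`, which diverges logarithmically as `r → 1`
(`neg_log_sub_le_integral`). Hence `g' = 0`. -/

/-! ### Riesz representation for real functionals -/

section Riesz

open Filter Topology Pointwise

variable {X : Type*} [TopologicalSpace X]

/-- The inclusion of nonnegative continuous functions into real continuous functions. -/
def ContinuousMap.nnrealToReal (f : C(X, ℝ≥0)) : C(X, ℝ) := ⟨fun x => f x, by fun_prop⟩

theorem ContinuousMap.nnrealToReal_add (f g : C(X, ℝ≥0)) :
    (f + g).nnrealToReal = f.nnrealToReal + g.nnrealToReal := by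
  ext x; simp [nnrealToReal]

theorem ContinuousMap.nnrealToReal_smul (r : ℝ≥0) (f : C(X, ℝ≥0)) :
    (r • f).nnrealToReal = (r : ℝ) • f.nnrealToReal := by
  ext x; simp [nnrealToReal]

/-- Riesz decomposition: any `g ≤ f₁ + f₂` splits as `min g f₁` plus a remainder below `f₂`. It
makes the supremum defining the positive part additive. -/
theorem ContinuousMap.image_le_add_eq (ℓ : C(X, ℝ) →ₗ[ℝ] ℝ) (f₁ f₂ : C(X, ℝ≥0)) :
    (fun g : C(X, ℝ≥0) => ℓ g.nnrealToReal) '' {g | ∀ x, g x ≤ (f₁ + f₂) x} =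
      (fun g : C(X, ℝ≥0) => ℓ g.nnrealToReal) '' {g | ∀ x, g x ≤ f₁ x} +
        (fun g : C(X, ℝ≥0) => ℓ g.nnrealToReal) '' {g | ∀ x, g x ≤ f₂ x} := by
  apply Subset.antisymm
  · rintro _ ⟨g, hg, rfl⟩
    refine ⟨_, ⟨⟨fun x => min (g x) (f₁ x), by fun_prop⟩, fun x => min_le_right _ _, rfl⟩, _,
      ⟨⟨fun x => g x - min (g x) (f₁ x), by fun_prop⟩, ?_, rfl⟩, ?_⟩
    · intro x
      have := hg x
      simp only [ContinuousMap.coe_mk, ContinuousMap.add_apply] at this ⊢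
      rw [tsub_le_iff_left]
      rcases le_total (g x) (f₁ x) with h | h
      · simp [h]
      · simpa [h] using this
    · simp only
      rw [← map_add, ← ContinuousMap.nnrealToReal_add]
      congr 2
      ext x
      simp
  · rintro _ ⟨_, ⟨g₁, h₁, rfl⟩, _, ⟨g₂, h₂, rfl⟩, rfl⟩
    refine ⟨g₁ + g₂, fun x => add_le_add (h₁ x) (h₂ x), ?_⟩
    simp only [ContinuousMap.nnrealToReal_add, map_add]

theorem ContinuousMap.image_le_smul_eq (ℓ : C(X, ℝ) →ₗ[ℝ] ℝ) (r : ℝ≥0) (f : C(X, ℝ≥0)) :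
    (fun g : C(X, ℝ≥0) => ℓ g.nnrealToReal) '' {g | ∀ x, g x ≤ (r • f) x} =
      (r : ℝ) • (fun g : C(X, ℝ≥0) => ℓ g.nnrealToReal) '' {g | ∀ x, g x ≤ f x} := by
  apply Subset.antisymm
  · rintro _ ⟨g, hg, rfl⟩
    rcases eq_or_ne r 0 with rfl | hr
    · refine ⟨_, ⟨0, fun x => zero_le, rfl⟩, ?_⟩
      have : g = (0 : ℝ≥0) • 0 := by
        ext x
        simpa using hg x
      simp only [this, ContinuousMap.nnrealToReal_smul, map_smul]
    · refine ⟨_, ⟨r⁻¹ • g, ?_, rfl⟩, ?_⟩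
      · intro x
        have := hg x
        simp only [ContinuousMap.smul_apply, smul_eq_mul] at this ⊢
        rwa [inv_mul_le_iff₀ (by positivity)]
      · simp only
        rw [← map_smul, ← ContinuousMap.nnrealToReal_smul, smul_smul, mul_inv_cancel₀ hr, one_smul]
  · rintro _ ⟨_, ⟨g, h, rfl⟩, rfl⟩
    refine ⟨r • g, fun x => ?_, ?_⟩
    · have := h x
      simp only [ContinuousMap.smul_apply, smul_eq_mul]
      gcongr
    · simp only [ContinuousMap.nnrealToReal_smul, map_smul]

variable [CompactSpace X]

theorem ContinuousMap.apply_le_of_le (ℓ : C(X, ℝ) →L[ℝ] ℝ) {f g : C(X, ℝ≥0)} (h : ∀ x, g x ≤ f x) :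
    ℓ g.nnrealToReal ≤ ‖ℓ‖ * ‖f.nnrealToReal‖ := by
  refine (le_abs_self _).trans ((ℓ.le_opNorm _).trans ?_)
  gcongr
  rw [ContinuousMap.norm_le _ (norm_nonneg _)]
  intro x
  refine le_trans ?_ (ContinuousMap.norm_coe_le_norm _ x)
  simpa [ContinuousMap.nnrealToReal] using h x

/-- The positive part of a bounded functional on `C(X, ℝ)`. -/
theorem ContinuousMap.exists_positive_ge (ℓ : C(X, ℝ) →L[ℝ] ℝ) :
    ∃ P : C(X, ℝ≥0) →ₗ[ℝ≥0] ℝ≥0,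
      (∀ f, ℓ f.nnrealToReal ≤ P f) ∧ (P 1 : ℝ) ≤ ‖ℓ‖ := by
  -- The positive part at `f` is the supremum of `ℓ g` over `0 ≤ g ≤ f`.
  let S : C(X, ℝ≥0) → Set ℝ := fun f => (fun g : C(X, ℝ≥0) => ℓ g.nnrealToReal) '' {g | ∀ x, g x ≤ f x}
  have hbdd : ∀ f, BddAbove (S f) := fun f => ⟨‖ℓ‖ * ‖f.nnrealToReal‖, by
    rintro _ ⟨g, hg, rfl⟩; exact apply_le_of_le ℓ hg⟩
  have hzero : ∀ f, 0 ∈ S f := fun f => ⟨0, fun x => zero_le, by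
    have : nnrealToReal (0 : C(X, ℝ≥0)) = 0 := by ext x; simp [nnrealToReal]
    simp [this]⟩
  have hne : ∀ f, (S f).Nonempty := fun f => ⟨0, hzero f⟩
  have hpos : ∀ f, 0 ≤ sSup (S f) := fun f => le_csSup (hbdd f) (hzero f)
  refine ⟨{ toFun := fun f => ⟨sSup (S f), hpos f⟩, map_add' := ?_, map_smul' := ?_ }, ?_, ?_⟩
  · intro f g
    apply NNReal.eq
    change sSup (S (f + g)) = sSup (S f) + sSup (S g)
    rw [← csSup_add (hne f) (hbdd f) (hne g) (hbdd g)]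
    congr 1
    exact image_le_add_eq (ℓ : C(X, ℝ) →ₗ[ℝ] ℝ) f g
  · intro r f
    apply NNReal.eq
    change sSup (S (r • f)) = r * sSup (S f)
    rw [← smul_eq_mul, ← Real.sSup_smul_of_nonneg r.coe_nonneg]
    congr 1
    exact image_le_smul_eq (ℓ : C(X, ℝ) →ₗ[ℝ] ℝ) r f
  · intro f
    exact le_csSup (hbdd f) ⟨f, fun x => le_rfl, rfl⟩
  · refine csSup_le (hne 1) ?_
    rintro _ ⟨g, hg, rfl⟩
    refine (apply_le_of_le ℓ hg).trans ?_
    refine mul_le_of_le_one_right (norm_nonneg ℓ) ?_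
    rw [ContinuousMap.norm_le _ zero_le_one]
    intro x
    simp [nnrealToReal]

variable [T2Space X] [MeasurableSpace X] [BorelSpace X]

theorem ContinuousMap.exists_measure_of_positive (P : C(X, ℝ≥0) →ₗ[ℝ≥0] ℝ≥0) :
    ∃ ρ : Measure X, (∀ f : C(X, ℝ≥0), ∫ x, (f x : ℝ) ∂ρ = P f) ∧ ρ univ = P 1 := by
  let Λ : CompactlySupportedContinuousMap X ℝ≥0 →ₗ[ℝ≥0] ℝ≥0 :=
    { toFun := fun f => P f.toContinuousMap
      map_add' := fun f g => P.map_add _ _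
      map_smul' := fun r f => P.map_smul _ _ }
  refine ⟨NNRealRMK.rieszMeasure Λ, fun f => ?_, ?_⟩
  · exact NNRealRMK.integral_rieszMeasure Λ (CompactlySupportedContinuousMap.continuousMapEquiv f)
  -- The mass comes from the `lintegral` formula: the Bochner integral of 1 would not exclude
  -- infinite mass.
  · have h := NNRealRMK.lintegral_rieszMeasure Λ
      (CompactlySupportedContinuousMap.continuousMapEquiv (1 : C(X, ℝ≥0)))
    have h1 : ∀ x, CompactlySupportedContinuousMap.continuousMapEquiv (1 : C(X, ℝ≥0)) x = 1 :=
      fun x => rfl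
    simp only [h1, ENNReal.coe_one, lintegral_one] at h
    exact h

/-- Bounded functionals on `C(X, ℝ)` are differences of finite positive measures. -/
theorem ContinuousMap.exists_measure_sub (ℓ : C(X, ℝ) →L[ℝ] ℝ) :
    ∃ ρ σ : Measure X, (∀ f : C(X, ℝ), ℓ f = ∫ x, f x ∂ρ - ∫ x, f x ∂σ) ∧
      ρ univ ≤ ENNReal.ofReal ‖ℓ‖ ∧ σ univ ≤ ENNReal.ofReal (2 * ‖ℓ‖) := by
  obtain ⟨P, hP, hP1⟩ := exists_positive_ge ℓ
  -- The negative part `P - ℓ`; its mass is at most `P 1 + |ℓ 1| ≤ 2‖ℓ‖`.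
  let Q : C(X, ℝ≥0) →ₗ[ℝ≥0] ℝ≥0 :=
    { toFun := fun f => ⟨P f - ℓ f.nnrealToReal, sub_nonneg.2 (hP f)⟩
      map_add' := fun f g => by
        apply NNReal.eq
        change (P (f + g) : ℝ) - _ = (P f - ℓ f.nnrealToReal) + (P g - ℓ g.nnrealToReal)
        rw [map_add, nnrealToReal_add, map_add, NNReal.coe_add]
        ring
      map_smul' := fun r f => by
        apply NNReal.eq
        change (P (r • f) : ℝ) - _ = r * (P f - ℓ f.nnrealToReal)
        rw [map_smul, nnrealToReal_smul, map_smul, smul_eq_mul, smul_eq_mul, NNReal.coe_mul]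
        ring }
  have hQ : ∀ f, (Q f : ℝ) = P f - ℓ f.nnrealToReal := fun f => rfl
  obtain ⟨ρ, hρ, hρ1⟩ := exists_measure_of_positive P
  obtain ⟨σ, hσ, hσ1⟩ := exists_measure_of_positive Q
  have : IsFiniteMeasure ρ := ⟨by rw [hρ1]; exact ENNReal.coe_lt_top⟩
  have : IsFiniteMeasure σ := ⟨by rw [hσ1]; exact ENNReal.coe_lt_top⟩
  have key : ∀ f : C(X, ℝ≥0), ℓ f.nnrealToReal = ∫ x, (f x : ℝ) ∂ρ - ∫ x, (f x : ℝ) ∂σ := by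
    intro f
    rw [hρ, hσ, hQ]
    ring
  refine ⟨ρ, σ, fun f => ?_, ?_, ?_⟩
  · let f₁ : C(X, ℝ≥0) := ⟨fun x => (f x).toNNReal, by fun_prop⟩
    let f₂ : C(X, ℝ≥0) := ⟨fun x => (-f x).toNNReal, by fun_prop⟩
    have hfx : ∀ x, f x = (f₁ x : ℝ) - f₂ x := fun x => by
      simp [f₁, f₂]
    have hf : f = f₁.nnrealToReal - f₂.nnrealToReal := by
      ext x
      exact hfx x
    have hint : ∀ (τ : Measure X) [IsFiniteMeasure τ] (h : C(X, ℝ≥0)),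
        Integrable (fun x => (h x : ℝ)) τ := fun τ _ h =>
      Continuous.integrable_of_hasCompactSupport (by fun_prop) (HasCompactSupport.of_compactSpace _)
    conv_lhs => rw [hf, map_sub, key, key]
    simp_rw [hfx]
    rw [integral_sub (hint ρ f₁) (hint ρ f₂), integral_sub (hint σ f₁) (hint σ f₂)]
    ring
  · rw [hρ1, ← ENNReal.ofReal_coe_nnreal]
    exact ENNReal.ofReal_le_ofReal hP1
  · rw [hσ1, ← ENNReal.ofReal_coe_nnreal, hQ]
    apply ENNReal.ofReal_le_ofReal
    have h1 : ‖(1 : C(X, ℝ≥0)).nnrealToReal‖ ≤ 1 := by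
      rw [ContinuousMap.norm_le _ zero_le_one]
      intro x
      simp [nnrealToReal]
    have h2 : |ℓ (1 : C(X, ℝ≥0)).nnrealToReal| ≤ ‖ℓ‖ :=
      (ℓ.le_opNorm _).trans (mul_le_of_le_one_right (norm_nonneg _) h1)
    have := neg_abs_le (ℓ (1 : C(X, ℝ≥0)).nnrealToReal)
    linarith

end Riesz

/-! ### Integration against a constant complex multiple of a measure -/

section ComplexIntegral

variable {X : Type*} [MeasurableSpace X]

theorem variation_withDensity_const (ρ : Measure X) [IsFiniteMeasure ρ] (c : ℂ) :
    (ρ.withDensityᵥ fun _ => c).variation = ‖c‖ₑ • ρ := by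
  rw [Measure.variation_withDensityᵥ (integrable_const c), withDensity_const]

theorem integral_withDensity_const (ρ : Measure X) [IsFiniteMeasure ρ] (c : ℂ) {f : X → ℂ}
    (hf : Integrable f ρ) :
    VectorMeasure.integral (ρ.withDensityᵥ fun _ => c) f (ContinuousLinearMap.mul ℝ ℂ) =
      c * ∫ x, f x ∂ρ := by
  have hint : ∀ {g : X → ℂ}, Integrable g ρ → (ρ.withDensityᵥ fun _ => c).Integrable g := by
    intro g hg
    rw [VectorMeasure.Integrable, variation_withDensity_const]
    exact hg.smul_measure enorm_ne_top
  refine Integrable.induction (P := fun f : X → ℂ => VectorMeasure.integral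
    (ρ.withDensityᵥ fun _ => c) f (ContinuousLinearMap.mul ℝ ℂ) = c * ∫ x, f x ∂ρ) ?_ ?_ ?_ ?_ hf
  · intro e s hs hμ
    rw [VectorMeasure.integral_eq_setToFun, setToFun_indicator_const _ hs]
    · rw [integral_indicator_const _ hs]
      have : (ρ.withDensityᵥ fun _ => c) s = ρ.real s * c := by
        rw [withDensityᵥ_apply (integrable_const c) hs]
        simp
      rw [transpose_eq_cbmApplyMeasure, cbmApplyMeasure_apply, this]
      simp
      ring
    · rw [variation_withDensity_const]
      simp [ENNReal.mul_eq_top]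
  · intro f g _ hf hg ihf ihg
    rw [VectorMeasure.integral_add (hint hf) (hint hg), ihf, ihg]
    simp only [Pi.add_apply]
    rw [integral_add hf hg, mul_add]
  · have hle : (ρ.withDensityᵥ fun _ => c).variation ≤ ‖c‖ₑ • ρ :=
      (variation_withDensity_const ρ c).le
    -- Both sides are continuous on `L¹(ρ)`; the left one factors through `L¹` of the variation,
    -- which is at most `‖c‖ₑ • ρ`.
    refine isClosed_eq ?_ (continuous_const.mul continuous_integral)
    convert! VectorMeasure.continuous_integral.comp
      (continuous_L1_toL1 (G := ℂ) ‖c‖ₑ enorm_ne_top hle) using 1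
    ext f
    exact VectorMeasure.integral_congr_ae (Integrable.coeFn_toL1 _).symm
  · intro f g h _ ih
    rw [← integral_congr_ae h, ← ih]
    refine (VectorMeasure.integral_congr_ae ?_).symm
    rw [variation_withDensity_const]
    exact Measure.ae_smul_measure h _

end ComplexIntegral

/-! ### Riesz representation for complex functionals -/

section ComplexRiesz

variable {X : Type*} [TopologicalSpace X] [CompactSpace X] [T2Space X] [MeasurableSpace X]
  [BorelSpace X]

theorem ContinuousMap.exists_complexMeasure_real (ℓ : C(X, ℝ) →L[ℝ] ℝ) (c : ℂ) :
    ∃ μ : ComplexMeasure X, (∀ f : C(X, ℂ), μ.Integrable f ∧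
      VectorMeasure.integral μ f (ContinuousLinearMap.mul ℝ ℂ) =
        c * (ℓ ⟨fun x => (f x).re, by fun_prop⟩ + Complex.I * ℓ ⟨fun x => (f x).im, by fun_prop⟩)) ∧
      μ.variation univ ≤ ‖c‖ₑ * ENNReal.ofReal (3 * ‖ℓ‖) := by
  obtain ⟨ρ, σ, h, hρ, hσ⟩ := exists_measure_sub ℓ
  have : IsFiniteMeasure ρ := ⟨hρ.trans_lt ENNReal.ofReal_lt_top⟩
  have : IsFiniteMeasure σ := ⟨hσ.trans_lt ENNReal.ofReal_lt_top⟩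
  have hint : ∀ (τ : Measure X) [IsFiniteMeasure τ] (f : C(X, ℂ)), Integrable f τ := fun τ _ f =>
    Continuous.integrable_of_hasCompactSupport (by fun_prop) (HasCompactSupport.of_compactSpace _)
  have hvar : ∀ (τ : Measure X) [IsFiniteMeasure τ] (f : C(X, ℂ)),
      (τ.withDensityᵥ fun _ => c).Integrable f := fun τ _ f => by
    rw [VectorMeasure.Integrable, variation_withDensity_const]
    exact (hint τ f).smul_measure enorm_ne_top
  refine ⟨(ρ.withDensityᵥ fun _ => c) - (σ.withDensityᵥ fun _ => c), fun f =>
    ⟨(hvar ρ f).sub_vectorMeasure (hvar σ f), ?_⟩, ?_⟩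
  · rw [VectorMeasure.integral_sub_vectorMeasure (hvar ρ f) (hvar σ f),
      integral_withDensity_const ρ c (hint ρ f), integral_withDensity_const σ c (hint σ f), h, h]
    have hsplit : ∀ (τ : Measure X) [IsFiniteMeasure τ], ∫ x, f x ∂τ =
        (∫ x, (f x).re ∂τ : ℝ) + Complex.I * (∫ x, (f x).im ∂τ : ℝ) := fun τ _ => by
      rw [← integral_re_add_im (hint τ f), mul_comm]
      rfl
    rw [hsplit ρ, hsplit σ]
    simp only [ContinuousMap.coe_mk, Complex.ofReal_sub]
    ring
  · refine (VectorMeasure.variation_sub_le univ).trans ?_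
    rw [variation_withDensity_const, variation_withDensity_const, ← smul_add, Measure.smul_apply,
      Measure.add_apply, smul_eq_mul]
    gcongr
    refine (add_le_add hρ hσ).trans ?_
    rw [← ENNReal.ofReal_add (by positivity) (by positivity)]
    apply ENNReal.ofReal_le_ofReal
    linarith

/-- Bounded functionals on `C(X, ℂ)` are given by complex measures. -/
theorem ContinuousMap.exists_complexMeasure (Φ : C(X, ℂ) →L[ℂ] ℂ) :
    ∃ μ : ComplexMeasure X, (∀ f : C(X, ℂ),
      VectorMeasure.integral μ f (ContinuousLinearMap.mul ℝ ℂ) = Φ f) ∧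
      μ.variation univ ≤ ENNReal.ofReal (6 * ‖Φ‖) := by
  let J : C(X, ℝ) →L[ℝ] C(X, ℂ) := Complex.ofRealCLM.compLeftContinuous ℝ X
  have hJ : ∀ f : C(X, ℝ), ‖J f‖ ≤ 1 * ‖f‖ := fun f => by
    rw [one_mul, ContinuousMap.norm_le _ (norm_nonneg _)]
    intro x
    simpa [J] using f.norm_coe_le_norm x
  -- On real functions `Φ = ℓ₁ + i ℓ₂`. Each part costs variation at most `3‖Φ‖`, whence the 6.
  let ℓ₁ : C(X, ℝ) →L[ℝ] ℝ := Complex.reCLM ∘L (Φ.restrictScalars ℝ) ∘L J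
  let ℓ₂ : C(X, ℝ) →L[ℝ] ℝ := Complex.imCLM ∘L (Φ.restrictScalars ℝ) ∘L J
  have hn₁ : ‖ℓ₁‖ ≤ ‖Φ‖ := ContinuousLinearMap.opNorm_le_bound _ (norm_nonneg _) fun f =>
    (Complex.abs_re_le_norm _).trans ((Φ.le_opNorm _).trans (by
      gcongr; simpa using hJ f))
  have hn₂ : ‖ℓ₂‖ ≤ ‖Φ‖ := ContinuousLinearMap.opNorm_le_bound _ (norm_nonneg _) fun f =>
    (Complex.abs_im_le_norm _).trans ((Φ.le_opNorm _).trans (by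
      gcongr; simpa using hJ f))
  obtain ⟨μ, hμ, hμv⟩ := exists_complexMeasure_real ℓ₁ 1
  obtain ⟨ν, hν, hνv⟩ := exists_complexMeasure_real ℓ₂ Complex.I
  have hre : ∀ f : C(X, ℝ), (ℓ₁ f : ℂ) + Complex.I * ℓ₂ f = Φ (J f) := fun f => by
    rw [mul_comm]
    exact Complex.re_add_im _
  refine ⟨μ + ν, fun f => ?_, ?_⟩
  · rw [VectorMeasure.integral_add_vectorMeasure (hμ f).1 (hν f).1, (hμ f).2, (hν f).2]
    have hf : f = J ⟨fun x => (f x).re, by fun_prop⟩ +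
        Complex.I • J ⟨fun x => (f x).im, by fun_prop⟩ := by
      ext x
      simp [J, mul_comm Complex.I, Complex.re_add_im]
    conv_rhs => rw [hf, map_add, map_smul, ← hre, ← hre, smul_eq_mul]
    ring
  · refine (VectorMeasure.variation_add_le univ).trans ?_
    rw [Measure.add_apply]
    refine (add_le_add hμv hνv).trans ?_
    have hI : ‖Complex.I‖ₑ = 1 := by simp [← ofReal_norm]
    rw [hI, enorm_one, one_mul, one_mul, ← ENNReal.ofReal_add (by positivity) (by positivity)]
    apply ENNReal.ofReal_le_ofReal
    linarith

end ComplexRiesz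

/-! ### Elementary properties of the integral operator -/

section IntegralOp

open Filter Topology

theorem mem_unitDisc {z : ℂ} : z ∈ unitDisc ↔ ‖z‖ < 1 := mem_ball_zero_iff

theorem isOpen_unitDisc : IsOpen unitDisc := isOpen_ball

theorem norm_real_mul_le {t : ℝ} (ht : t ∈ Icc (0 : ℝ) 1) (z : ℂ) : ‖(t : ℂ) * z‖ ≤ ‖z‖ := by
  rw [norm_mul, Complex.norm_real, Real.norm_of_nonneg ht.1]
  exact mul_le_of_le_one_left (norm_nonneg _) ht.2

theorem real_mul_mem_unitDisc {t : ℝ} (ht : t ∈ Icc (0 : ℝ) 1) {z : ℂ} (hz : z ∈ unitDisc) :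
    (t : ℂ) * z ∈ unitDisc :=
  mem_unitDisc.2 ((norm_real_mul_le ht z).trans_lt (mem_unitDisc.1 hz))

theorem deriv_mem_analyticDisc {g : ℂ → ℂ} (hg : g ∈ analyticDisc) : deriv g ∈ analyticDisc :=
  DifferentiableOn.deriv hg isOpen_unitDisc

theorem continuousOn_radial {f : ℂ → ℂ} {z : ℂ} (hf : ContinuousOn f (closedBall 0 ‖z‖)) :
    ContinuousOn (fun t : ℝ => f (t * z)) (Icc 0 1) :=
  hf.comp (by fun_prop) fun t ht => mem_closedBall_zero_iff.2 (norm_real_mul_le ht z)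

theorem closedBall_norm_subset_unitDisc {z : ℂ} (hz : z ∈ unitDisc) :
    closedBall 0 ‖z‖ ⊆ unitDisc :=
  closedBall_subset_ball (mem_unitDisc.1 hz)

theorem continuousOn_closedBall_of_analyticDisc {f : ℂ → ℂ} (hf : f ∈ analyticDisc) {z : ℂ}
    (hz : z ∈ unitDisc) : ContinuousOn f (closedBall 0 ‖z‖) :=
  (DifferentiableOn.continuousOn hf).mono (closedBall_norm_subset_unitDisc hz)

theorem intervalIntegrable_radial {f : ℂ → ℂ} {z : ℂ} (hf : ContinuousOn f (closedBall 0 ‖z‖)) :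
    IntervalIntegrable (fun t : ℝ => f (t * z)) volume 0 1 :=
  ContinuousOn.intervalIntegrable (by rw [uIcc_of_le zero_le_one]; exact continuousOn_radial hf)

theorem integralOp_mem_analyticDisc {g f : ℂ → ℂ} (hg : g ∈ analyticDisc)
    (hf : f ∈ analyticDisc) : integralOp g f ∈ analyticDisc := by
  have hd : DifferentiableOn ℂ (fun ζ => f ζ * deriv g ζ) (ball 0 1) :=
    DifferentiableOn.mul hf (deriv_mem_analyticDisc hg)
  -- A primitive of `f g'` on the disc; integrating along the segment gives `T_g f = H - H 0`.
  obtain ⟨H, hH⟩ := hd.isExactOn_ball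
  have heq : EqOn (integralOp g f) (fun z => H z - H 0) unitDisc := by
    intro z hz
    have hderiv : ∀ t ∈ uIcc (0 : ℝ) 1,
        HasDerivAt (fun t : ℝ => H (t * z)) (z * (f (t * z) * deriv g (t * z))) t := by
      intro t ht
      rw [uIcc_of_le zero_le_one] at ht
      have h1 : HasDerivAt (fun t : ℝ => (t : ℂ) * z) z t := by
        simpa using (Complex.ofRealCLM.hasDerivAt (x := t)).mul_const z
      have := (hH _ (real_mul_mem_unitDisc ht hz)).comp_of_eq t h1 rfl
      rw [mul_comm]
      exact this
    have hint : IntervalIntegrable (fun t : ℝ => z * (f (t * z) * deriv g (t * z))) volume 0 1 :=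
      (intervalIntegrable_radial
        (continuousOn_closedBall_of_analyticDisc (f := fun ζ => f ζ * deriv g ζ) hd hz)).const_mul z
    have := intervalIntegral.integral_eq_sub_of_hasDerivAt hderiv hint
    rw [integralOp, ← intervalIntegral.integral_const_mul, this]
    simp
  refine DifferentiableOn.congr ?_ heq
  exact fun z hz => ((hH z hz).differentiableAt.sub_const _).differentiableWithinAt

variable {g : ℂ → ℂ} {z : ℂ}

theorem integralOp_congr {f₁ f₂ : ℂ → ℂ} (h : EqOn f₁ f₂ (closedBall 0 ‖z‖)) :
    integralOp g f₁ z = integralOp g f₂ z := by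
  unfold integralOp
  congr 1
  refine intervalIntegral.integral_congr fun t ht => ?_
  rw [uIcc_of_le zero_le_one] at ht
  rw [h (mem_closedBall_zero_iff.2 (norm_real_mul_le ht z))]

theorem integralOp_add (hg : g ∈ analyticDisc) (hz : z ∈ unitDisc) {f₁ f₂ : ℂ → ℂ}
    (h₁ : ContinuousOn f₁ (closedBall 0 ‖z‖)) (h₂ : ContinuousOn f₂ (closedBall 0 ‖z‖)) :
    integralOp g (fun ζ => f₁ ζ + f₂ ζ) z = integralOp g f₁ z + integralOp g f₂ z := by
  have hd := continuousOn_closedBall_of_analyticDisc (deriv_mem_analyticDisc hg) hz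
  have i₁ : IntervalIntegrable (fun t : ℝ => f₁ (t * z) * deriv g (t * z)) volume 0 1 :=
    intervalIntegrable_radial (h₁.mul hd)
  have i₂ : IntervalIntegrable (fun t : ℝ => f₂ (t * z) * deriv g (t * z)) volume 0 1 :=
    intervalIntegrable_radial (h₂.mul hd)
  unfold integralOp
  rw [← mul_add, ← intervalIntegral.integral_add i₁ i₂]
  simp only [add_mul]

theorem integralOp_const_mul (c : ℂ) (f : ℂ → ℂ) :
    integralOp g (fun ζ => c * f ζ) z = c * integralOp g f z := by
  unfold integralOp
  simp only [mul_assoc, intervalIntegral.integral_const_mul]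
  ring

theorem exists_norm_deriv_radial_le (hg : g ∈ analyticDisc) (hz : z ∈ unitDisc) :
    ∃ B : ℝ, 0 ≤ B ∧ ∀ t ∈ Icc (0 : ℝ) 1, ‖deriv g (t * z)‖ ≤ B := by
  obtain ⟨B, hB⟩ := (isCompact_closedBall (0 : ℂ) ‖z‖).exists_bound_of_continuousOn
    (continuousOn_closedBall_of_analyticDisc (deriv_mem_analyticDisc hg) hz)
  refine ⟨B, (norm_nonneg _).trans (hB 0 (by simp)), fun t ht => hB _ ?_⟩
  exact mem_closedBall_zero_iff.2 (norm_real_mul_le ht z)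

theorem exists_norm_integralOp_le (hg : g ∈ analyticDisc) (hz : z ∈ unitDisc) :
    ∃ B : ℝ, 0 ≤ B ∧ ∀ (f : ℂ → ℂ) (M : ℝ), (∀ ζ ∈ closedBall (0 : ℂ) ‖z‖, ‖f ζ‖ ≤ M) →
      ‖integralOp g f z‖ ≤ B * M := by
  obtain ⟨B, hB0, hB⟩ := exists_norm_deriv_radial_le hg hz
  refine ⟨B, hB0, fun f M hM => ?_⟩
  have hM0 : 0 ≤ M := (norm_nonneg _).trans (hM 0 (by simp))
  have h : ‖∫ t in (0 : ℝ)..1, f (t * z) * deriv g (t * z)‖ ≤ M * B * |(1 : ℝ) - 0| := by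
    refine intervalIntegral.norm_integral_le_of_norm_le_const fun t ht => ?_
    rw [uIoc_of_le zero_le_one] at ht
    have ht' := Ioc_subset_Icc_self ht
    rw [norm_mul]
    exact mul_le_mul (hM _ (mem_closedBall_zero_iff.2 (norm_real_mul_le ht' z))) (hB t ht')
      (norm_nonneg _) hM0
  rw [integralOp, norm_mul]
  calc ‖z‖ * _ ≤ 1 * (M * B * |(1 : ℝ) - 0|) :=
        mul_le_mul (mem_unitDisc.1 hz).le h (norm_nonneg _) zero_le_one
    _ = B * M := by simp [mul_comm]

theorem hasSum_integralOp (hg : g ∈ analyticDisc) (hz : z ∈ unitDisc) {a : ℕ → ℂ}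
    (ha : Summable fun n => ‖a n‖) {F : ℂ → ℂ}
    (hF : ∀ ζ ∈ closedBall (0 : ℂ) ‖z‖, HasSum (fun n => a n * ζ ^ n) (F ζ)) :
    HasSum (fun n => a n * integralOp g (fun ζ => ζ ^ n) z) (integralOp g F z) := by
  obtain ⟨B, hB0, hB⟩ := exists_norm_deriv_radial_le hg hz
  have hd := continuousOn_closedBall_of_analyticDisc (deriv_mem_analyticDisc hg) hz
  simp_rw [← integralOp_const_mul]
  unfold integralOp
  refine HasSum.mul_left z ?_
  refine intervalIntegral.hasSum_integral_of_dominated_convergence (fun n _ => ‖a n‖ * B)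
    (fun n => ?_) (fun n => ?_) ?_ ?_ ?_
  · rw [uIoc_of_le zero_le_one]
    refine ContinuousOn.aestronglyMeasurable ?_ measurableSet_Ioc
    refine (continuousOn_radial (f := fun ζ => a n * ζ ^ n * deriv g ζ) ?_).mono Ioc_subset_Icc_self
    exact ContinuousOn.mul (by fun_prop) hd
  · refine Eventually.of_forall fun t ht => ?_
    rw [uIoc_of_le zero_le_one] at ht
    have ht' := Ioc_subset_Icc_self ht
    rw [norm_mul, norm_mul, norm_pow]
    refine mul_le_mul ?_ (hB t ht') (norm_nonneg _) (norm_nonneg _)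
    refine mul_le_of_le_one_right (norm_nonneg _) (pow_le_one₀ (norm_nonneg _) ?_)
    exact (mem_unitDisc.1 (real_mul_mem_unitDisc ht' hz)).le
  · exact Eventually.of_forall fun t _ => ha.mul_right B
  · exact intervalIntegrable_const
  · refine Eventually.of_forall fun t ht => ?_
    rw [uIoc_of_le zero_le_one] at ht
    refine HasSum.mul_right _ (hF _ ?_)
    exact mem_closedBall_zero_iff.2 (norm_real_mul_le (Ioc_subset_Icc_self ht) z)

/-- The bridge between the two objects: evaluating `G_{g,z}` at `w` is applying `T_g` to a Cauchy
kernel. -/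
theorem conj_kernelG (w : ℂ) :
    conj (kernelG g z w) = integralOp g (fun ζ => 1 / (1 - conj w * ζ)) z := by
  rw [kernelG, Complex.conj_conj, integralOp]
  congr 1
  refine intervalIntegral.integral_congr fun t _ => ?_
  simp only [hardyKernel, map_div₀, map_one, map_sub, map_mul, Complex.conj_conj]
  ring_nf

theorem enorm_le_hInftyNorm (f : ℂ → ℂ) (hz : z ∈ unitDisc) : ‖f z‖ₑ ≤ hInftyNorm f :=
  le_iSup₂ (f := fun z (_ : z ∈ unitDisc) => ‖f z‖ₑ) z hz

theorem discAlgebra_subset_hInfty : discAlgebra ⊆ hInfty := by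
  rintro f ⟨hf, F, hF, hfF⟩
  refine ⟨hf, ?_⟩
  obtain ⟨B, hB⟩ := (isCompact_closedBall (0 : ℂ) 1).exists_bound_of_continuousOn hF
  refine lt_of_le_of_lt (iSup₂_le fun z hz => ?_) (ENNReal.ofReal_lt_top (r := B))
  rw [hfF hz, ← ofReal_norm]
  exact ENNReal.ofReal_le_ofReal (hB z (ball_subset_closedBall hz))

end IntegralOp

/-! ### The pairing with measures, and (c) ⇒ (a) -/

section Duality

open Filter Topology

/-- The pairing is declared bilinear only over `ℝ`; complex homogeneity holds because the measure
acts by complex multiplication. -/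
theorem integral_const_mul_complexMeasure {X : Type*} [MeasurableSpace X] (μ : ComplexMeasure X)
    (c : ℂ) (f : X → ℂ) :
    VectorMeasure.integral μ (fun x => c * f x) (ContinuousLinearMap.mul ℝ ℂ) =
      c * VectorMeasure.integral μ f (ContinuousLinearMap.mul ℝ ℂ) := by
  rw [VectorMeasure.integral_eq_setToFun, VectorMeasure.integral_eq_setToFun]
  refine setToFun_smul (𝕜 := ℂ) _ (fun c s x => ?_) c f
  rw [transpose_eq_cbmApplyMeasure, cbmApplyMeasure_apply, cbmApplyMeasure_apply]
  simp [mul_assoc]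

theorem hasSum_integral_conj_pow (μ : ComplexMeasure Circle) [IsFiniteMeasure μ.variation]
    {a : ℕ → ℂ} (ha : Summable fun n => ‖a n‖) {F : Circle → ℂ}
    (hF : ∀ ξ : Circle, HasSum (fun n => a n * conj (ξ : ℂ) ^ n) (F ξ)) :
    HasSum (fun n => a n * VectorMeasure.integral μ (fun ξ : Circle => conj (ξ : ℂ) ^ n)
      (ContinuousLinearMap.mul ℝ ℂ)) (VectorMeasure.integral μ F (ContinuousLinearMap.mul ℝ ℂ)) := by
  simp_rw [← integral_const_mul_complexMeasure]
  refine VectorMeasure.hasSum_integral_of_dominated_convergence (fun n _ => ‖a n‖)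
    (fun n => ?_) (fun n => ?_) ?_ ?_ ?_
  · exact Continuous.aestronglyMeasurable (by fun_prop)
  · exact Eventually.of_forall fun ξ => by simp [Circle.norm_coe]
  · exact Eventually.of_forall fun _ => ha
  · exact integrable_const _
  · exact Eventually.of_forall hF

theorem eq_of_hasSum_pow_mul {b c : ℕ → ℂ} {G : ℂ → ℂ}
    (hb : ∀ w ∈ unitDisc, HasSum (fun n => w ^ n * b n) (G w))
    (hc : ∀ w ∈ unitDisc, HasSum (fun n => w ^ n * c n) (G w)) : b = c := by
  have h : ∀ d : ℕ → ℂ, (∀ w ∈ unitDisc, HasSum (fun n => w ^ n * d n) (G w)) →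
      HasFPowerSeriesAt G (FormalMultilinearSeries.ofScalars ℂ d) 0 := by
    intro d hd
    rw [hasFPowerSeriesAt_iff]
    filter_upwards [isOpen_unitDisc.mem_nhds (mem_unitDisc.2 (by simp : ‖(0 : ℂ)‖ < 1))] with w hw
    simpa [FormalMultilinearSeries.coeff_ofScalars] using hd w hw
  have heq := (h b hb).eq_formalMultilinearSeries (h c hc)
  ext n
  simpa [FormalMultilinearSeries.coeff_ofScalars] using congrArg (fun p => p.coeff n) heq

theorem hasSum_geometric_mul {w ζ : ℂ} (hw : ‖w‖ < 1) (hζ : ‖ζ‖ ≤ 1) :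
    HasSum (fun n : ℕ => w ^ n * ζ ^ n) (1 / (1 - w * ζ)) := by
  simp_rw [← mul_pow, one_div]
  apply hasSum_geometric_of_norm_lt_one
  rw [norm_mul]
  nlinarith [norm_nonneg w, norm_nonneg ζ]

theorem summable_norm_pow {w : ℂ} (hw : ‖w‖ < 1) : Summable fun n : ℕ => ‖w ^ n‖ := by
  simp_rw [norm_pow]
  exact summable_geometric_of_lt_one (norm_nonneg _) hw

variable {g : ℂ → ℂ} {z : ℂ}

/-- Both transforms have power series in `w` obtained by expanding the geometric kernel under the
integral, and coefficients are unique. -/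
theorem conj_integralOp_pow_eq (hg : g ∈ analyticDisc) (hz : z ∈ unitDisc)
    (μ : ComplexMeasure Circle) [IsFiniteMeasure μ.variation]
    (h : EqOn (kernelG g z) (cauchyTransform μ) unitDisc) (n : ℕ) :
    conj (integralOp g (fun ζ => ζ ^ n) z) =
      VectorMeasure.integral μ (fun ξ : Circle => conj (ξ : ℂ) ^ n)
        (ContinuousLinearMap.mul ℝ ℂ) := by
  refine congrFun (eq_of_hasSum_pow_mul (G := kernelG g z)
    (b := fun n => conj (integralOp g (fun ζ => ζ ^ n) z))
    (c := fun n => VectorMeasure.integral μ (fun ξ : Circle => conj (ξ : ℂ) ^ n)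
      (ContinuousLinearMap.mul ℝ ℂ)) (fun w hw => ?_) fun w hw => ?_) n
  · have hw' : ‖conj w‖ < 1 := by simpa using mem_unitDisc.1 hw
    have := hasSum_integralOp hg hz (summable_norm_pow hw')
      (F := fun ζ => 1 / (1 - conj w * ζ)) fun ζ hζ => hasSum_geometric_mul hw'
        (mem_unitDisc.1 (closedBall_norm_subset_unitDisc hz hζ)).le
    rw [← conj_kernelG] at this
    simpa using (Complex.hasSum_conj'.2 this)
  · rw [h hw]
    have hw' := mem_unitDisc.1 hw
    refine hasSum_integral_conj_pow μ (summable_norm_pow hw') fun ξ => ?_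
    rw [mul_comm _ w]
    exact hasSum_geometric_mul hw' (by simp [Circle.norm_coe])

theorem hasSum_dilation {f : ℂ → ℂ} (hf : f ∈ analyticDisc) {r : ℝ} (hr : r ∈ Ioo (0 : ℝ) 1) :
    ∃ a : ℕ → ℂ, (Summable fun n => ‖a n‖) ∧
      ∀ ζ : ℂ, ‖ζ‖ ≤ 1 → HasSum (fun n => a n * ζ ^ n) (f (r * ζ)) := by
  have h : ∀ ζ : ℂ, ‖ζ‖ ≤ 1 → HasSum (fun n : ℕ =>
      ((n.factorial : ℂ)⁻¹ * iteratedDeriv n f 0 * (r : ℂ) ^ n) * ζ ^ n) (f (r * ζ)) := by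
    intro ζ hζ
    have hm : (r : ℂ) * ζ ∈ ball (0 : ℂ) 1 := by
      rw [mem_ball_zero_iff, norm_mul, Complex.norm_real, Real.norm_of_nonneg hr.1.le]
      nlinarith [hr.1, hr.2, norm_nonneg ζ]
    refine (Complex.hasSum_taylorSeries_on_ball hf hm).congr_fun ?_
    intro n
    simp only [sub_zero, mul_pow, smul_eq_mul]
    ring
  refine ⟨_, ?_, h⟩
  -- Summability in `ℂ` is absolute, so the expansion at `ζ = 1` already sums the norms of the
  -- coefficients.
  have := (h 1 (by simp)).summable.norm
  simpa using this

theorem integralOp_dilation_eq (hg : g ∈ analyticDisc) (hz : z ∈ unitDisc)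
    (μ : ComplexMeasure Circle) [IsFiniteMeasure μ.variation]
    (h : EqOn (kernelG g z) (cauchyTransform μ) unitDisc) {f : ℂ → ℂ} (hf : f ∈ analyticDisc)
    {r : ℝ} (hr : r ∈ Ioo (0 : ℝ) 1) :
    conj (integralOp g (fun ζ => f (r * ζ)) z) =
      VectorMeasure.integral μ (fun ξ : Circle => conj (f (r * ξ)))
        (ContinuousLinearMap.mul ℝ ℂ) := by
  obtain ⟨a, ha, hfa⟩ := hasSum_dilation hf hr
  have h1 := Complex.hasSum_conj'.2 (hasSum_integralOp hg hz ha (F := fun ζ => f (r * ζ)) fun ζ hζ =>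
    hfa ζ (mem_unitDisc.1 (closedBall_norm_subset_unitDisc hz hζ)).le)
  have h2 := hasSum_integral_conj_pow μ (a := fun n => conj (a n)) (by simpa using ha)
    (F := fun ξ => conj (f (r * ξ))) fun ξ => by
      have := Complex.hasSum_conj'.2 (hfa ξ (by simp [Circle.norm_coe]))
      simpa using this
  refine h1.unique ?_
  simp_rw [map_mul, conj_integralOp_pow_eq hg hz μ h]
  exact h2

theorem enorm_mul_le_one : ‖ContinuousLinearMap.mul ℝ ℂ‖ₑ ≤ 1 := by
  rw [← ofReal_norm]
  exact ENNReal.ofReal_le_one.2 (ContinuousLinearMap.opNorm_mul_le ℝ ℂ)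

theorem enorm_integralOp_dilation_le (hg : g ∈ analyticDisc) (hz : z ∈ unitDisc)
    (μ : ComplexMeasure Circle) [IsFiniteMeasure μ.variation]
    (h : EqOn (kernelG g z) (cauchyTransform μ) unitDisc) {f : ℂ → ℂ} (hf : f ∈ analyticDisc)
    {r : ℝ} (hr : r ∈ Ioo (0 : ℝ) 1) :
    ‖integralOp g (fun ζ => f (r * ζ)) z‖ₑ ≤ μ.variation univ * hInftyNorm f := by
  have : ‖integralOp g (fun ζ => f (r * ζ)) z‖ₑ = ‖conj (integralOp g (fun ζ => f (r * ζ)) z)‖ₑ := by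
    rw [← ofReal_norm, ← ofReal_norm, Complex.norm_conj]
  rw [this, integralOp_dilation_eq hg hz μ h hf hr]
  refine (VectorMeasure.enorm_integral_le_of_enorm_le_const (C := hInftyNorm f)
    (Eventually.of_forall fun ξ => ?_)).trans ?_
  · rw [← ofReal_norm, Complex.norm_conj, ofReal_norm]
    refine enorm_le_hInftyNorm f (mem_unitDisc.2 ?_)
    rw [norm_mul, Complex.norm_real, Real.norm_of_nonneg hr.1.le]
    simpa [Circle.norm_coe] using hr.2
  · rw [mul_comm (μ.variation univ)]
    gcongr
    exact mul_le_of_le_one_right zero_le enorm_mul_le_one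

/-- Dilations preserve the compact disc of radius `‖z‖`, so bounds for `f` and `g'` there dominate
the integrands uniformly in `r`. -/
theorem tendsto_integralOp_dilation (hg : g ∈ analyticDisc) (hz : z ∈ unitDisc) {f : ℂ → ℂ}
    (hf : f ∈ analyticDisc) :
    Tendsto (fun r : ℝ => integralOp g (fun ζ => f (r * ζ)) z) (𝓝[<] 1) (𝓝 (integralOp g f z)) := by
  obtain ⟨B, hB0, hB⟩ := exists_norm_deriv_radial_le hg hz
  have hcf := continuousOn_closedBall_of_analyticDisc hf hz
  obtain ⟨M, hM⟩ := (isCompact_closedBall (0 : ℂ) ‖z‖).exists_bound_of_continuousOn hcf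
  have hd := continuousOn_closedBall_of_analyticDisc (deriv_mem_analyticDisc hg) hz
  have hmem : ∀ᶠ r : ℝ in 𝓝[<] 1, r ∈ Ioo (0 : ℝ) 1 := Ioo_mem_nhdsLT zero_lt_one
  have hmaps : ∀ r ∈ Ioo (0 : ℝ) 1, MapsTo (fun ζ : ℂ => (r : ℂ) * ζ) (closedBall 0 ‖z‖)
      (closedBall 0 ‖z‖) := fun r hr ζ hζ => mem_closedBall_zero_iff.2
    ((norm_real_mul_le ⟨hr.1.le, hr.2.le⟩ ζ).trans (mem_closedBall_zero_iff.1 hζ))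
  unfold integralOp
  refine Tendsto.const_mul z ?_
  refine intervalIntegral.tendsto_integral_filter_of_dominated_convergence (fun _ => M * B)
    ?_ ?_ intervalIntegrable_const ?_
  · filter_upwards [hmem] with r hr
    rw [uIoc_of_le zero_le_one]
    refine ContinuousOn.aestronglyMeasurable ?_ measurableSet_Ioc
    refine (continuousOn_radial (f := fun ζ => f (r * ζ) * deriv g ζ) ?_).mono Ioc_subset_Icc_self
    exact ContinuousOn.mul (hcf.comp (by fun_prop) (hmaps r hr)) hd
  · filter_upwards [hmem] with r hr
    refine Eventually.of_forall fun t ht => ?_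
    rw [uIoc_of_le zero_le_one] at ht
    have ht' := Ioc_subset_Icc_self ht
    have hm : ‖f (r * (t * z))‖ ≤ M :=
      hM _ (hmaps r hr (mem_closedBall_zero_iff.2 (norm_real_mul_le ht' z)))
    rw [norm_mul]
    exact mul_le_mul hm (hB t ht') (norm_nonneg _) ((norm_nonneg _).trans hm)
  · refine Eventually.of_forall fun t ht => ?_
    rw [uIoc_of_le zero_le_one] at ht
    refine Tendsto.mul_const _ ?_
    have hdisc := real_mul_mem_unitDisc (Ioc_subset_Icc_self ht) hz
    have hca : ContinuousAt f (t * z) :=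
      (DifferentiableOn.continuousOn hf).continuousAt (isOpen_unitDisc.mem_nhds hdisc)
    have hlim : Tendsto (fun r : ℝ => (r : ℂ) * (t * z)) (𝓝[<] 1) (𝓝 (t * z)) := by
      have : Continuous fun r : ℝ => (r : ℂ) * (t * z) := by fun_prop
      simpa using (this.tendsto 1).mono_left nhdsWithin_le_nhds
    exact hca.tendsto.comp hlim

/-- If all the functions `G_{g,z}` lie in a bounded subset of `𝒦`, then `T_g` is bounded on
`H^∞`. -/
theorem boundedIntoHInfty_of_iSup_cauchyNorm_lt_top (hg : g ∈ analyticDisc)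
    (h : (⨆ z ∈ unitDisc, cauchyNorm (kernelG g z)) < ∞) :
    BoundedIntoHInfty hInfty hInftyNorm (integralOp g) := by
  set S := ⨆ z ∈ unitDisc, cauchyNorm (kernelG g z) with hS
  -- The infimum defining `cauchyNorm` need not be attained; the slack 1 supplies a measure of
  -- variation below `S + 1`.
  have hlt : S + 1 < ∞ := ENNReal.add_lt_top.2 ⟨h, ENNReal.one_lt_top⟩
  have key : ∀ f ∈ hInfty, hInftyNorm (integralOp g f) ≤ (S + 1) * hInftyNorm f := by
    intro f hf
    refine iSup₂_le fun z hz => ?_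
    have hz1 : cauchyNorm (kernelG g z) < S + 1 :=
      (le_iSup₂ (f := fun z (_ : z ∈ unitDisc) => cauchyNorm (kernelG g z)) z hz).trans_lt
        (ENNReal.lt_add_right h.ne one_ne_zero)
    obtain ⟨μ, hμ⟩ := iInf_lt_iff.1 hz1
    obtain ⟨heq, hμ⟩ := iInf_lt_iff.1 hμ
    have : IsFiniteMeasure μ.variation := ⟨hμ.trans hlt⟩
    refine le_of_tendsto ((continuous_enorm.tendsto _).comp
      (tendsto_integralOp_dilation hg hz hf.1)) ?_
    filter_upwards [Ioo_mem_nhdsLT zero_lt_one] with r hr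
    refine (enorm_integralOp_dilation_le hg hz μ heq hf.1 hr).trans ?_
    gcongr
  refine ⟨(S + 1).toNNReal, fun f hf => ?_⟩
  rw [ENNReal.coe_toNNReal hlt.ne]
  refine ⟨⟨integralOp_mem_analyticDisc hg hf.1, ?_⟩, key f hf⟩
  exact (key f hf).trans_lt (ENNReal.mul_lt_top hlt hf.2)

end Duality

/-! ### Extension of functionals, and (b) ⇒ (c) -/

section HahnBanach

open Filter Topology

/-- The functions on `𝕋` whose complex conjugate belongs to the disc algebra. -/
def conjDiscAlgebra : Submodule ℂ C(Circle, ℂ) where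
  carrier := {u | ∃ f : ℂ → ℂ, DiffContOnCl ℂ f unitDisc ∧ ∀ ξ : Circle, u ξ = conj (f ξ)}
  add_mem' := by
    rintro u v ⟨f, hf, hu⟩ ⟨k, hk, hv⟩
    exact ⟨f + k, hf.add hk, fun ξ => by simp [hu, hv]⟩
  zero_mem' := ⟨0, diffContOnCl_const, fun ξ => by simp⟩
  smul_mem' := by
    rintro c u ⟨f, hf, hu⟩
    exact ⟨conj c • f, hf.const_smul _, fun ξ => by simp [hu]⟩

theorem closure_unitDisc : closure unitDisc = closedBall (0 : ℂ) 1 :=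
  closure_ball 0 one_ne_zero

theorem continuousOn_closedBall_of_diffContOnCl {f : ℂ → ℂ} (hf : DiffContOnCl ℂ f unitDisc) :
    ContinuousOn f (closedBall 0 1) := by
  rw [← closure_unitDisc]
  exact hf.continuousOn

theorem mem_discAlgebra_of_diffContOnCl {f : ℂ → ℂ} (hf : DiffContOnCl ℂ f unitDisc) :
    f ∈ discAlgebra :=
  ⟨hf.differentiableOn, f, continuousOn_closedBall_of_diffContOnCl hf, fun _ _ => rfl⟩

theorem norm_le_of_diffContOnCl {f : ℂ → ℂ} (hf : DiffContOnCl ℂ f unitDisc) {M : ℝ}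
    (hM : ∀ ξ : Circle, ‖f ξ‖ ≤ M) {z : ℂ} (hz : ‖z‖ ≤ 1) : ‖f z‖ ≤ M := by
  refine Complex.norm_le_of_forall_mem_frontier_norm_le isBounded_ball hf (fun ξ hξ => ?_)
    (show z ∈ closure unitDisc by rwa [closure_unitDisc, mem_closedBall_zero_iff])
  rw [frontier_ball _ one_ne_zero] at hξ
  exact hM ⟨ξ, by simpa [Submonoid.unitSphere] using hξ⟩

variable {g : ℂ → ℂ} {z : ℂ}

/-- By the maximum principle, boundary values determine the function, so the functional on
`conjDiscAlgebra` does not depend on the chosen extension. -/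
theorem integralOp_eq_of_eq_on_circle (hz : z ∈ unitDisc) {f k : ℂ → ℂ}
    (hf : DiffContOnCl ℂ f unitDisc) (hk : DiffContOnCl ℂ k unitDisc)
    (h : ∀ ξ : Circle, f ξ = k ξ) : integralOp g f z = integralOp g k z := by
  refine integralOp_congr fun ζ hζ => ?_
  have hζ1 := (mem_unitDisc.1 (closedBall_norm_subset_unitDisc hz hζ)).le
  have := norm_le_of_diffContOnCl (hf.sub hk) (M := 0) (fun ξ => by simp [h]) hζ1
  exact sub_eq_zero.1 (norm_le_zero_iff.1 this)

theorem diffContOnCl_kernel {w : ℂ} (hw : w ∈ unitDisc) :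
    DiffContOnCl ℂ (fun ζ => 1 / (1 - conj w * ζ)) unitDisc := by
  have hne : ∀ ζ ∈ closedBall (0 : ℂ) 1, 1 - conj w * ζ ≠ 0 := by
    intro ζ hζ h
    have h1 : conj w * ζ = 1 := (sub_eq_zero.1 h).symm
    have h2 : ‖w‖ * ‖ζ‖ = 1 := by
      rw [← Complex.norm_conj w, ← norm_mul, h1, norm_one]
    have := mem_unitDisc.1 hw
    have := mem_closedBall_zero_iff.1 hζ
    nlinarith [norm_nonneg w, norm_nonneg ζ]
  refine DifferentiableOn.diffContOnCl ?_
  rw [closure_unitDisc]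
  exact DifferentiableOn.div (by fun_prop) (by fun_prop) hne

theorem integralOp_add_of_diffContOnCl (hg : g ∈ analyticDisc) (hz : z ∈ unitDisc) {f k : ℂ → ℂ}
    (hf : DiffContOnCl ℂ f unitDisc) (hk : DiffContOnCl ℂ k unitDisc) :
    integralOp g (f + k) z = integralOp g f z + integralOp g k z :=
  integralOp_add hg hz (continuousOn_closedBall_of_analyticDisc hf.differentiableOn hz)
    (continuousOn_closedBall_of_analyticDisc hk.differentiableOn hz)

/-- The functional `u ↦ conj (T_g (conj u) z)` extends to `C(𝕋)` with control of its norm. -/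
theorem exists_extension_integralOp (hg : g ∈ analyticDisc) (hz : z ∈ unitDisc) {C : ℝ≥0}
    (hC : ∀ f ∈ discAlgebra, hInftyNorm (integralOp g f) ≤ C * hInftyNorm f) :
    ∃ Φ : C(Circle, ℂ) →L[ℂ] ℂ, ‖Φ‖ ≤ C ∧ ∀ (u : C(Circle, ℂ)) (f : ℂ → ℂ),
      DiffContOnCl ℂ f unitDisc → (∀ ξ : Circle, u ξ = conj (f ξ)) →
        Φ u = conj (integralOp g f z) := by
  choose F hFd hFu using fun u : conjDiscAlgebra => u.2
  have huniq : ∀ (u : conjDiscAlgebra) (f : ℂ → ℂ), DiffContOnCl ℂ f unitDisc →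
      (∀ ξ : Circle, (u : C(Circle, ℂ)) ξ = conj (f ξ)) →
        integralOp g (F u) z = integralOp g f z := by
    intro u f hf hu
    refine integralOp_eq_of_eq_on_circle hz (hFd u) hf fun ξ => ?_
    exact (starRingEnd ℂ).injective ((hFu u ξ).symm.trans (hu ξ))
  let φ : conjDiscAlgebra →ₗ[ℂ] ℂ :=
    { toFun := fun u => conj (integralOp g (F u) z)
      map_add' := fun u v => by
        rw [huniq (u + v) (F u + F v) ((hFd u).add (hFd v)) fun ξ => by simp [← hFu],
          integralOp_add_of_diffContOnCl hg hz (hFd u) (hFd v), map_add]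
      map_smul' := fun c u => by
        rw [huniq (c • u) (fun ζ => conj c * F u ζ) ((hFd u).const_smul (conj c))
          fun ξ => by simp [← hFu], integralOp_const_mul]
        simp }
  have hφ : ∀ u : conjDiscAlgebra, ‖φ u‖ ≤ C * ‖u‖ := by
    intro u
    have h1 := (enorm_le_hInftyNorm (integralOp g (F u)) hz).trans
      (hC _ (mem_discAlgebra_of_diffContOnCl (hFd u)))
    have h2 : hInftyNorm (F u) ≤ ENNReal.ofReal ‖u‖ := by
      refine iSup₂_le fun ζ hζ => ?_
      rw [← ofReal_norm]
      refine ENNReal.ofReal_le_ofReal (norm_le_of_diffContOnCl (hFd u) (fun ξ => ?_)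
        (mem_unitDisc.1 hζ).le)
      rw [← Complex.norm_conj, ← hFu]
      exact ContinuousMap.norm_coe_le_norm (u : C(Circle, ℂ)) ξ
    have h3 : ENNReal.ofReal ‖integralOp g (F u) z‖ ≤ ENNReal.ofReal (C * ‖u‖) := by
      rw [ofReal_norm, ENNReal.ofReal_mul C.coe_nonneg, ENNReal.ofReal_coe_nnreal]
      exact h1.trans (by gcongr)
    have h4 := (ENNReal.ofReal_le_ofReal_iff (by positivity)).1 h3
    calc ‖φ u‖ = ‖integralOp g (F u) z‖ := Complex.norm_conj _
      _ ≤ C * ‖u‖ := h4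
  obtain ⟨Φ, hΦ, hn⟩ := exists_extension_norm_eq conjDiscAlgebra (φ.mkContinuous C hφ)
  refine ⟨Φ, hn.trans_le (φ.mkContinuous_norm_le C.2 hφ), fun u f hf hu => ?_⟩
  have := hΦ ⟨u, f, hf, hu⟩
  refine this.trans ?_
  change conj _ = _
  rw [huniq ⟨u, f, hf, hu⟩ f hf hu]

/-- The measure representing the extended functional is tested on `1/(1 - w conj ξ)`, the conjugate
of a kernel in the disc algebra: one side is `Kμ(w)`, the other `G_{g,z}(w)`. -/
theorem cauchyNorm_kernelG_le (hg : g ∈ analyticDisc) (hz : z ∈ unitDisc) {C : ℝ≥0}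
    (hC : ∀ f ∈ discAlgebra, hInftyNorm (integralOp g f) ≤ C * hInftyNorm f) :
    cauchyNorm (kernelG g z) ≤ ENNReal.ofReal (6 * C) := by
  obtain ⟨Φ, hΦ, h⟩ := exists_extension_integralOp hg hz hC
  obtain ⟨μ, hμ, hv⟩ := ContinuousMap.exists_complexMeasure Φ
  refine (iInf₂_le μ ?_).trans (hv.trans (ENNReal.ofReal_le_ofReal (by gcongr)))
  intro w hw
  have hk := diffContOnCl_kernel hw
  have hcont : Continuous fun ξ : Circle => conj (1 / (1 - conj w * (ξ : ℂ))) := by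
    refine Complex.continuous_conj.comp ?_
    exact (continuousOn_closedBall_of_diffContOnCl hk).comp_continuous (by fun_prop)
      fun ξ => by simp [Circle.norm_coe]
  have h1 := h ⟨_, hcont⟩ _ hk fun ξ => rfl
  rw [← conj_kernelG, Complex.conj_conj] at h1
  rw [← h1, ← hμ, cauchyTransform]
  congr 1
  ext ξ
  simp [mul_comm]

theorem iSup_cauchyNorm_lt_top_of_boundedIntoHInfty (hg : g ∈ analyticDisc)
    (h : BoundedIntoHInfty discAlgebra hInftyNorm (integralOp g)) :
    (⨆ z ∈ unitDisc, cauchyNorm (kernelG g z)) < ∞ := by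
  obtain ⟨C, hC⟩ := h
  exact lt_of_le_of_lt (iSup₂_le fun z hz => cauchyNorm_kernelG_le hg hz fun f hf => (hC f hf).2)
    ENNReal.ofReal_lt_top

end HahnBanach

/-! ### Approximating point masses by absolutely continuous measures -/

section PointEvaluation

open Filter Topology

instance isFiniteMeasure_arcLength : IsFiniteMeasure arcLength := by
  unfold arcLength
  infer_instance

theorem arcLength_ball_pos (η : Circle) {ε : ℝ} (hε : 0 < ε) : 0 < arcLength (ball η ε) := by
  have hcont : Continuous fun t : ℝ => Circle.exp t := by fun_prop
  rw [arcLength, Measure.map_apply hcont.measurable isOpen_ball.measurableSet]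
  set U := (fun t : ℝ => Circle.exp t) ⁻¹' ball η ε with hU
  have hUo : IsOpen U := isOpen_ball.preimage hcont
  have hmem : Complex.arg η ∈ U := by
    rw [hU, mem_preimage, Circle.exp_arg]
    exact mem_ball_self hε
  -- The argument may be `π`, an endpoint, so only the closure of the open interval is sure to
  -- contain it.
  have hcl : Complex.arg (η : ℂ) ∈ closure (Ioo (-Real.pi) Real.pi) := by
    rw [closure_Ioo (by linarith [Real.pi_pos])]
    exact ⟨(Complex.neg_pi_lt_arg _).le, Complex.arg_le_pi _⟩
  have hne : (U ∩ Ioo (-Real.pi) Real.pi).Nonempty := mem_closure_iff.1 hcl U hUo hmem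
  rw [Measure.restrict_apply hUo.measurableSet]
  refine lt_of_lt_of_le ((hUo.inter isOpen_Ioo).measure_pos volume hne) (measure_mono ?_)
  exact inter_subset_inter_right _ Ioo_subset_Ioc_self

/-- Point evaluations on `𝕋` are approximated by absolutely continuous measures of norm one. -/
theorem exists_absolutelyContinuous_approx (η : Circle) {ε : ℝ} (hε : 0 < ε) :
    ∃ μ : ComplexMeasure Circle,
      VectorMeasure.AbsolutelyContinuous μ arcLength.toENNRealVectorMeasure ∧
      μ.variation univ ≤ 1 ∧ ∀ (f : Circle → ℂ) (M : ℝ), Continuous f →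
        (∀ ξ : Circle, dist ξ η < ε → ‖f ξ - f η‖ ≤ M) →
          ‖VectorMeasure.integral μ f (ContinuousLinearMap.mul ℝ ℂ) - f η‖ ≤ M := by
  set ρ : Measure Circle := arcLength.restrict (ball η ε) with hρ
  set m : ℝ := ρ.real univ with hm
  have huniv : ρ univ = ENNReal.ofReal m := (ofReal_measureReal).symm
  have hm0 : 0 < m := by
    rw [hm, measureReal_def, ENNReal.toReal_pos_iff]
    refine ⟨?_, measure_lt_top _ _⟩
    rw [hρ, Measure.restrict_apply_univ]
    exact arcLength_ball_pos η hε
  refine ⟨ρ.withDensityᵥ fun _ => ((m⁻¹ : ℝ) : ℂ), ?_, ?_, ?_⟩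
  · refine VectorMeasure.AbsolutelyContinuous.mk fun s hs h0 => ?_
    rw [Measure.toENNRealVectorMeasure_apply_measurable hs] at h0
    rw [withDensityᵥ_apply (integrable_const _) hs]
    apply setIntegral_measure_zero
    exact le_antisymm ((Measure.restrict_apply_le _ _).trans h0.le) zero_le
  · rw [variation_withDensity_const, Measure.smul_apply, smul_eq_mul, huniv, ← ofReal_norm,
      ← ENNReal.ofReal_mul (norm_nonneg _), Complex.norm_real,
      Real.norm_of_nonneg (inv_nonneg.2 hm0.le), inv_mul_cancel₀ hm0.ne', ENNReal.ofReal_one]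
  · intro f M hf hM
    have hfi : Integrable f ρ :=
      hf.integrable_of_hasCompactSupport (HasCompactSupport.of_compactSpace _)
    rw [integral_withDensity_const ρ _ hfi]
    have hsub : ((m⁻¹ : ℝ) : ℂ) * ∫ ξ, f ξ ∂ρ - f η = ((m⁻¹ : ℝ) : ℂ) * ∫ ξ, (f ξ - f η) ∂ρ := by
      rw [integral_sub hfi (integrable_const _), integral_const, ← hm, mul_sub, Complex.real_smul,
        ← mul_assoc, ← Complex.ofReal_mul, inv_mul_cancel₀ hm0.ne', Complex.ofReal_one, one_mul]
    have hle : ‖∫ ξ, (f ξ - f η) ∂ρ‖ ≤ M * m := by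
      refine norm_integral_le_of_norm_le_const ?_
      filter_upwards [ae_restrict_mem isOpen_ball.measurableSet] with ξ hξ using hM ξ hξ
    rw [hsub, norm_mul, Complex.norm_real, Real.norm_of_nonneg (inv_nonneg.2 hm0.le)]
    calc m⁻¹ * _ ≤ m⁻¹ * (M * m) := by gcongr
      _ = M := by field_simp

theorem one_sub_le_norm_one_sub_conj_mul (ξ : Circle) {ζ : ℂ} {r : ℝ} (hζ : ‖ζ‖ ≤ r) :
    1 - r ≤ ‖1 - conj (ξ : ℂ) * ζ‖ := by
  have h := norm_sub_norm_le (1 : ℂ) (conj (ξ : ℂ) * ζ)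
  rw [norm_one, norm_mul, Complex.norm_conj, Circle.norm_coe, one_mul] at h
  linarith

theorem norm_kernel_le (ξ : Circle) {ζ : ℂ} {r : ℝ} (hr : r < 1) (hζ : ‖ζ‖ ≤ r) :
    ‖1 / (1 - conj (ξ : ℂ) * ζ)‖ ≤ 1 / (1 - r) := by
  rw [norm_div, norm_one]
  exact one_div_le_one_div_of_le (by linarith) (one_sub_le_norm_one_sub_conj_mul ξ hζ)

theorem one_sub_conj_mul_ne_zero (ξ : Circle) {ζ : ℂ} {r : ℝ} (hr : r < 1) (hζ : ‖ζ‖ ≤ r) :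
    1 - conj (ξ : ℂ) * ζ ≠ 0 := by
  rw [← norm_pos_iff]
  linarith [one_sub_le_norm_one_sub_conj_mul ξ hζ]

/-- Lipschitz in the boundary point, uniformly for `‖ζ‖ ≤ r`; this turns weak approximation of a
point mass into uniform approximation of its Cauchy transform. -/
theorem norm_kernel_sub_le (ξ η : Circle) {ζ : ℂ} {r : ℝ} (hr : r < 1) (hζ : ‖ζ‖ ≤ r) :
    ‖1 / (1 - conj (ξ : ℂ) * ζ) - 1 / (1 - conj (η : ℂ) * ζ)‖ ≤
      dist ξ η * (1 / (1 - r) * (1 / (1 - r))) := by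
  have h1 := one_sub_conj_mul_ne_zero ξ hr hζ
  have h2 := one_sub_conj_mul_ne_zero η hr hζ
  have heq : 1 / (1 - conj (ξ : ℂ) * ζ) - 1 / (1 - conj (η : ℂ) * ζ) =
      conj ((ξ : ℂ) - η) * ζ * (1 / (1 - conj (ξ : ℂ) * ζ) * (1 / (1 - conj (η : ℂ) * ζ))) := by
    rw [map_sub, div_sub_div _ _ h1 h2, div_mul_div_comm, ← mul_div_assoc]
    congr 1
    ring
  have hr0 : 0 ≤ 1 / (1 - r) := by
    have : 0 < 1 - r := by linarith
    positivity
  rw [heq, norm_mul, norm_mul, norm_mul, Complex.norm_conj, ← dist_eq_norm]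
  refine mul_le_mul ?_ (mul_le_mul (norm_kernel_le ξ hr hζ) (norm_kernel_le η hr hζ)
    (norm_nonneg _) hr0) (by positivity) dist_nonneg
  exact mul_le_of_le_one_right dist_nonneg (hζ.trans hr.le)

theorem continuousOn_kernel (ξ : Circle) {r : ℝ} (hr : r < 1) :
    ContinuousOn (fun ζ => 1 / (1 - conj (ξ : ℂ) * ζ)) (closedBall 0 r) :=
  ContinuousOn.div (by fun_prop) (by fun_prop) fun _ hζ =>
    one_sub_conj_mul_ne_zero ξ hr (mem_closedBall_zero_iff.1 hζ)

theorem continuous_kernel {ζ : ℂ} (hζ : ‖ζ‖ < 1) :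
    Continuous fun ξ : Circle => 1 / (1 - conj (ξ : ℂ) * ζ) :=
  Continuous.div (by fun_prop) (by fun_prop) fun ξ => one_sub_conj_mul_ne_zero ξ hζ le_rfl

theorem continuousOn_cauchyTransform (μ : ComplexMeasure Circle) [IsFiniteMeasure μ.variation]
    {r : ℝ} (hr : r < 1) : ContinuousOn (cauchyTransform μ) (closedBall 0 r) := by
  refine VectorMeasure.continuousOn_of_dominated (bound := fun _ => 1 / (1 - r))
    (fun ζ hζ => ?_) (fun ζ hζ => ?_) (integrable_const _) ?_
  · exact (continuous_kernel
      ((mem_closedBall_zero_iff.1 hζ).trans_lt hr)).aestronglyMeasurable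
  · exact Eventually.of_forall fun ξ => norm_kernel_le ξ hr (mem_closedBall_zero_iff.1 hζ)
  · exact Eventually.of_forall fun ξ => continuousOn_kernel ξ hr

variable {g : ℂ → ℂ} {z : ℂ}

/-- The kernel at `η` is the Cauchy transform of a point mass, hence a limit, uniform on `‖ζ‖ ≤
‖z‖`, of elements of `𝒦_a` of norm at most 1, and `f ↦ T_g f z` is continuous for that convergence.
-/
theorem norm_integralOp_kernel_le (hg : g ∈ analyticDisc) (hz : z ∈ unitDisc) {C : ℝ≥0}
    (hC : ∀ f ∈ cauchyAC, hInftyNorm (integralOp g f) ≤ C * cauchyNorm f) (η : Circle) :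
    ‖integralOp g (fun ζ => 1 / (1 - conj (η : ℂ) * ζ)) z‖ ≤ C := by
  obtain ⟨B, hB0, hB⟩ := exists_norm_integralOp_le hg hz
  have hz1 := mem_unitDisc.1 hz
  set L : ℝ := 1 / (1 - ‖z‖) * (1 / (1 - ‖z‖)) with hL
  have hL0 : 0 ≤ L := by
    have : 0 < 1 - ‖z‖ := by linarith
    positivity
  have key : ∀ ε : ℝ, 0 < ε →
      ‖integralOp g (fun ζ => 1 / (1 - conj (η : ℂ) * ζ)) z‖ ≤ C + B * L * ε := by
    intro ε hε
    obtain ⟨μ, hac, hvar, happ⟩ := exists_absolutelyContinuous_approx η hε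
    have : IsFiniteMeasure μ.variation := ⟨hvar.trans_lt ENNReal.one_lt_top⟩
    have h1 : ‖integralOp g (cauchyTransform μ) z‖ ≤ C := by
      have h := (enorm_le_hInftyNorm (integralOp g (cauchyTransform μ)) hz).trans
        (hC _ ⟨μ, hac, fun _ _ => rfl⟩)
      have h' : cauchyNorm (cauchyTransform μ) ≤ 1 := (iInf₂_le μ fun _ _ => rfl).trans hvar
      have h'' : ‖integralOp g (cauchyTransform μ) z‖ₑ ≤ C :=
        h.trans (mul_le_of_le_one_right zero_le h')
      rw [← ofReal_norm, ← ENNReal.ofReal_coe_nnreal] at h''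
      exact (ENNReal.ofReal_le_ofReal_iff C.coe_nonneg).1 h''
    have h2 := hB (fun ζ => cauchyTransform μ ζ + (-1) * (1 / (1 - conj (η : ℂ) * ζ))) (L * ε)
      fun ζ hζ => by
        have hζ' := mem_closedBall_zero_iff.1 hζ
        rw [neg_one_mul, ← sub_eq_add_neg]
        refine happ (fun ξ => 1 / (1 - conj (ξ : ℂ) * ζ)) (L * ε)
          (continuous_kernel (hζ'.trans_lt hz1)) fun ξ hξ => ?_
        refine (norm_kernel_sub_le ξ η hz1 hζ').trans ?_
        rw [mul_comm]
        gcongr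
    rw [integralOp_add hg hz (continuousOn_cauchyTransform μ hz1)
      ((continuousOn_kernel η hz1).const_mul _), integralOp_const_mul, neg_one_mul,
      ← sub_eq_add_neg] at h2
    have h3 := norm_le_norm_add_norm_sub (integralOp g (cauchyTransform μ) z)
      (integralOp g (fun ζ => 1 / (1 - conj (η : ℂ) * ζ)) z)
    nlinarith
  refine ge_of_tendsto (f := fun ε => (C : ℝ) + B * L * ε)
    (?_ : Tendsto _ (𝓝[>] (0 : ℝ)) (𝓝 (C : ℝ))) ?_
  · have : Continuous fun ε : ℝ => (C : ℝ) + B * L * ε := by fun_prop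
    simpa using (this.tendsto 0).mono_left nhdsWithin_le_nhds
  · filter_upwards [self_mem_nhdsWithin] with ε hε using key ε hε

end PointEvaluation

/-! ### Logarithmic divergence of the Fourier coefficients -/

section Divergence

open Filter Topology

theorem integral_exp_mul_eq_iteratedDeriv {d : ℂ → ℂ} (hd : d ∈ analyticDisc) {ρ : ℝ}
    (hρ : ρ ∈ Ioo (0 : ℝ) 1) (k : ℕ) :
    ∫ θ in (0 : ℝ)..2 * Real.pi,
        Complex.exp (-(k * (θ * Complex.I))) * d (ρ * Complex.exp (θ * Complex.I)) =
      ρ ^ k * (2 * Real.pi * (iteratedDeriv k d 0 / k.factorial)) := by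
  have hdc : DiffContOnCl ℂ d (ball 0 ρ) := by
    refine DifferentiableOn.diffContOnCl (DifferentiableOn.mono hd ?_)
    exact closure_ball_subset_closedBall.trans (closedBall_subset_ball hρ.2)
  have h := hdc.circleIntegral_one_div_sub_center_pow_smul hρ.1 k
  have hρ0 : (ρ : ℂ) ≠ 0 := Complex.ofReal_ne_zero.2 hρ.1.ne'
  rw [circleIntegral] at h
  have hI : ∀ θ : ℝ, deriv (circleMap 0 ρ) θ • (1 / (circleMap 0 ρ θ - 0) ^ (k + 1)) •
      d (circleMap 0 ρ θ) = (Complex.I / ρ ^ k) *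
        (Complex.exp (-(k * (θ * Complex.I))) * d (ρ * Complex.exp (θ * Complex.I))) := by
    intro θ
    have he := Complex.exp_ne_zero (θ * Complex.I)
    rw [deriv_circleMap, Complex.exp_neg, Complex.exp_nat_mul]
    simp only [circleMap, zero_add, sub_zero, smul_eq_mul, mul_pow]
    field_simp
    ring
  simp_rw [hI] at h
  rw [intervalIntegral.integral_const_mul, smul_eq_mul] at h
  have hk : (ρ : ℂ) ^ k ≠ 0 := pow_ne_zero _ hρ0
  have hf : (k.factorial : ℂ) ≠ 0 := Nat.cast_ne_zero.2 k.factorial_ne_zero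
  field_simp at h ⊢
  linear_combination h

theorem neg_log_sub_le_integral {r : ℝ} (hr : r ∈ Ioo (0 : ℝ) 1) (k : ℕ) :
    -Real.log (1 - r) - k ≤ ∫ t in (0 : ℝ)..1, (t * r) ^ k / (1 - t * r) := by
  have hpos : ∀ t ∈ Icc (0 : ℝ) 1, 0 < 1 - t * r := fun t ht => by
    nlinarith [ht.1, ht.2, hr.1, hr.2]
  have hderiv : ∀ t ∈ uIcc (0 : ℝ) 1,
      HasDerivAt (fun t => -Real.log (1 - t * r) - k * t) (r / (1 - t * r) - k) t := by
    intro t ht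
    rw [uIcc_of_le zero_le_one] at ht
    have h1 : HasDerivAt (fun t : ℝ => 1 - t * r) (-r) t := by
      simpa using ((hasDerivAt_id t).mul_const r).const_sub 1
    have h2 := (h1.log (hpos t ht).ne').neg.sub ((hasDerivAt_id t).const_mul (k : ℝ))
    convert! h2 using 1
    ring
  have hc1 : ContinuousOn (fun t : ℝ => r / (1 - t * r) - k) (Icc 0 1) :=
    (ContinuousOn.div (by fun_prop) (by fun_prop) fun t ht => (hpos t ht).ne').sub
      continuousOn_const
  have hc2 : ContinuousOn (fun t : ℝ => (t * r) ^ k / (1 - t * r)) (Icc 0 1) :=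
    ContinuousOn.div (by fun_prop) (by fun_prop) fun t ht => (hpos t ht).ne'
  have hi1 : IntervalIntegrable (fun t : ℝ => r / (1 - t * r) - k) volume 0 1 :=
    ContinuousOn.intervalIntegrable (by rwa [uIcc_of_le zero_le_one])
  have hi2 : IntervalIntegrable (fun t : ℝ => (t * r) ^ k / (1 - t * r)) volume 0 1 :=
    ContinuousOn.intervalIntegrable (by rwa [uIcc_of_le zero_le_one])
  have h := intervalIntegral.integral_eq_sub_of_hasDerivAt hderiv hi1
  have hmono := intervalIntegral.integral_mono_on zero_le_one hi1 hi2 fun t ht => by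
    have hp := hpos t ht
    rw [div_sub' hp.ne']
    refine div_le_div_of_nonneg_right ?_ hp.le
    -- Bernoulli: `(tr)^k ≥ 1 - k(1 - tr)`, and `1` is weakened to `r` to match the derivative of
    -- `-log(1 - tr)`.
    have hb := one_add_mul_le_pow (a := t * r - 1) (by nlinarith [ht.1, hr.1]) k
    rw [add_sub_cancel] at hb
    nlinarith [hr.2]
  refine le_trans (le_of_eq ?_) hmono
  rw [h]
  simp

variable {d : ℂ → ℂ}

/-- After Fubini, the inner integral over `θ` is Cauchy's coefficient formula on the circle of
radius `tr`. -/
theorem integral_mul_iteratedDeriv_eq (hd : d ∈ analyticDisc) {r : ℝ} (hr : r ∈ Ioo (0 : ℝ) 1)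
    (k : ℕ) :
    ∫ θ in (0 : ℝ)..2 * Real.pi, Complex.exp (-(k * (θ * Complex.I))) *
        ∫ t in (0 : ℝ)..1, d (t * (r * Complex.exp (θ * Complex.I))) / (1 - t * r) =
      (∫ t in (0 : ℝ)..1, (t * r) ^ k / (1 - t * r) : ℝ) *
        (2 * Real.pi * (iteratedDeriv k d 0 / k.factorial)) := by
  have h2π : (0 : ℝ) ≤ 2 * Real.pi := by positivity
  have hpos : ∀ t ∈ Icc (0 : ℝ) 1, 0 < 1 - t * r := fun t ht => by
    nlinarith [ht.1, ht.2, hr.1, hr.2]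
  let F : ℝ → ℝ → ℂ := fun θ t => Complex.exp (-(k * (θ * Complex.I))) *
    (d (t * (r * Complex.exp (θ * Complex.I))) / (1 - t * r))
  have hF : ContinuousOn (Function.uncurry F) (Icc 0 (2 * Real.pi) ×ˢ Icc 0 1) := by
    refine ContinuousOn.mul (by fun_prop) (ContinuousOn.div ?_ (by fun_prop) ?_)
    · refine (DifferentiableOn.continuousOn hd).comp (by fun_prop) fun p hp => ?_
      refine real_mul_mem_unitDisc hp.2 (mem_unitDisc.2 ?_)
      rw [norm_mul, Complex.norm_exp_ofReal_mul_I, Complex.norm_real, mul_one,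
        Real.norm_of_nonneg hr.1.le]
      exact hr.2
    · intro p hp
      exact_mod_cast (hpos p.2 hp.2).ne'
  have hint : Integrable (Function.uncurry F)
      ((volume.restrict (Ioc 0 (2 * Real.pi))).prod (volume.restrict (Ioc (0 : ℝ) 1))) := by
    rw [Measure.prod_restrict]
    refine IntegrableOn.mono_set ?_ (prod_mono Ioc_subset_Icc_self Ioc_subset_Icc_self)
    exact hF.integrableOn_compact (isCompact_Icc.prod isCompact_Icc)
  have hswap := integral_integral_swap hint
  simp_rw [← intervalIntegral.integral_of_le h2π, ← intervalIntegral.integral_of_le zero_le_one]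
    at hswap
  have hleft : ∀ θ, ∫ t in (0 : ℝ)..1, F θ t = Complex.exp (-(k * (θ * Complex.I))) *
      ∫ t in (0 : ℝ)..1, d (t * (r * Complex.exp (θ * Complex.I))) / (1 - t * r) := fun θ =>
    intervalIntegral.integral_const_mul _ _
  simp_rw [hleft] at hswap
  rw [hswap, ← intervalIntegral.integral_ofReal, ← intervalIntegral.integral_mul_const]
  refine intervalIntegral.integral_congr_ae (Eventually.of_forall fun t ht => ?_)
  rw [uIoc_of_le zero_le_one] at ht
  -- The half-open interval excludes `t = 0`, so the circle is nondegenerate.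
  have htr : t * r ∈ Ioo (0 : ℝ) 1 :=
    ⟨mul_pos ht.1 hr.1, by linarith [hpos t (Ioc_subset_Icc_self ht)]⟩
  have h := integral_exp_mul_eq_iteratedDeriv hd htr k
  have hFt : ∀ θ, F θ t = (Complex.exp (-(k * (θ * Complex.I))) *
      d (((t * r : ℝ) : ℂ) * Complex.exp (θ * Complex.I))) * (1 / (1 - t * r)) := fun θ => by
    simp only [F, Complex.ofReal_mul, mul_assoc]
    ring
  simp_rw [hFt]
  rw [intervalIntegral.integral_mul_const, h]
  push_cast
  ring

theorem iteratedDeriv_eq_zero_of_integral_le (hd : d ∈ analyticDisc) {C : ℝ}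
    (hC : ∀ r ∈ Ioo (0 : ℝ) 1, ∀ η : Circle,
      r * ‖∫ t in (0 : ℝ)..1, d (t * (r * (η : ℂ))) / (1 - t * r)‖ ≤ C) (k : ℕ) :
    iteratedDeriv k d 0 = 0 := by
  set a : ℝ := ‖iteratedDeriv k d 0 / k.factorial‖ with ha
  have hbound : ∀ r ∈ Ioo (0 : ℝ) 1, r * ((-Real.log (1 - r) - k) * a) ≤ C := by
    intro r hr
    have h := integral_mul_iteratedDeriv_eq hd hr k
    have hle : ‖∫ θ in (0 : ℝ)..2 * Real.pi, Complex.exp (-(k * (θ * Complex.I))) *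
        ∫ t in (0 : ℝ)..1, d (t * (r * Complex.exp (θ * Complex.I))) / (1 - t * r)‖ ≤
          C / r * |2 * Real.pi - 0| := by
      refine intervalIntegral.norm_integral_le_of_norm_le_const fun θ _ => ?_
      have he : ‖Complex.exp (-(k * (θ * Complex.I)))‖ = 1 := by
        have : -((k : ℂ) * (θ * Complex.I)) = ((-(k * θ) : ℝ) : ℂ) * Complex.I := by
          push_cast
          ring
        rw [this, Complex.norm_exp_ofReal_mul_I]
      rw [norm_mul, he, one_mul, le_div_iff₀' hr.1]
      have := hC r hr (Circle.exp θ)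
      rwa [Circle.coe_exp] at this
    rw [h, norm_mul, norm_mul, ← ha] at hle
    have h2π : ‖(2 * Real.pi : ℂ)‖ = 2 * Real.pi := by
      rw [norm_mul, Complex.norm_real, Real.norm_of_nonneg Real.pi_pos.le, Complex.norm_two]
    rw [h2π, Complex.norm_real, sub_zero, abs_of_pos Real.two_pi_pos] at hle
    have hJ := (neg_log_sub_le_integral hr k).trans (Real.le_norm_self _)
    have h3 : (-Real.log (1 - r) - k) * a ≤ C / r := by
      refine le_of_mul_le_mul_right ?_ Real.two_pi_pos
      refine le_trans ?_ hle
      rw [mul_assoc, mul_comm a]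
      gcongr
    rwa [le_div_iff₀' hr.1] at h3
  have ha0 : a = 0 := by
    by_contra hne
    have hapos : 0 < a := lt_of_le_of_ne (norm_nonneg _) (Ne.symm hne)
    obtain ⟨N, hN⟩ := exists_nat_gt (max ((2 * |C|) / a + k) 1)
    have hN1 : (1 : ℝ) < N := (le_max_right _ _).trans_lt hN
    have hN2 : (2 * |C|) / a + k < N := (le_max_left _ _).trans_lt hN
    have he : Real.exp (-N) ≤ 1 / 2 := by
      have h1 := Real.add_one_le_exp (N : ℝ)
      rw [Real.exp_neg, ← one_div]
      exact one_div_le_one_div_of_le two_pos (by linarith)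
    -- This radius gives `-log(1 - r) = N` exactly and `r ≥ 1/2`; `N` was chosen so that `(N - k) a
    -- > 2|C|`.
    have hb := hbound (1 - Real.exp (-N)) ⟨by linarith, by linarith [Real.exp_pos (-N : ℝ)]⟩
    rw [sub_sub_cancel, Real.log_exp, neg_neg] at hb
    have h4 : 2 * |C| < (N - k) * a := by
      rw [← div_lt_iff₀ hapos]
      linarith
    have h5 : 1 / 2 * ((N - k) * a) ≤ (1 - Real.exp (-N)) * ((N - k) * a) := by
      refine mul_le_mul_of_nonneg_right (by linarith) ?_
      linarith [abs_nonneg C]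
    linarith [le_abs_self C]
  have := norm_eq_zero.1 (ha.symm.trans ha0)
  exact (div_eq_zero_iff.1 this).resolve_right (Nat.cast_ne_zero.2 k.factorial_ne_zero)

end Divergence

/-! ### Part (ii) and the assembled theorem -/

section MainTheorem

variable {g : ℂ → ℂ}

theorem exists_eq_const_of_boundedIntoHInfty (hg : g ∈ analyticDisc)
    (h : BoundedIntoHInfty cauchyAC cauchyNorm (integralOp g)) :
    ∃ c : ℂ, ∀ z ∈ unitDisc, g z = c := by
  obtain ⟨C, hC⟩ := h
  have hzero : ∀ k, iteratedDeriv k (deriv g) 0 = 0 := by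
    refine iteratedDeriv_eq_zero_of_integral_le (deriv_mem_analyticDisc hg) (C := C) ?_
    intro r hr η
    have hz : (r : ℂ) * η ∈ unitDisc := by
      rw [mem_unitDisc, norm_mul, Complex.norm_real, Circle.norm_coe, mul_one,
        Real.norm_of_nonneg hr.1.le]
      exact hr.2
    have h := norm_integralOp_kernel_le hg hz (fun f hf => (hC f hf).2) η
    rw [integralOp, norm_mul, norm_mul, Complex.norm_real, Circle.norm_coe, mul_one,
      Real.norm_of_nonneg hr.1.le] at h
    convert h using 5 with t
    -- With `z = rη` the kernel becomes the real weight `1/(1 - tr)`.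
    have hη : conj (η : ℂ) * η = 1 := by
      rw [mul_comm, Complex.mul_conj, Circle.normSq_coe, Complex.ofReal_one]
    have : conj (η : ℂ) * (t * (r * η)) = t * r := by linear_combination (t * r : ℂ) * hη
    rw [this]
    ring
  refine ⟨g 0, fun z hz => ?_⟩
  have hs := Complex.hasSum_taylorSeries_on_ball hg hz
  have h0 := hasSum_single (f := fun n : ℕ =>
    (n.factorial : ℂ)⁻¹ • (z - 0) ^ n • iteratedDeriv n g 0) 0 fun n hn => by
      obtain ⟨m, rfl⟩ := Nat.exists_eq_succ_of_ne_zero hn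
      simp [iteratedDeriv_succ', hzero]
  rw [hs.unique h0]
  simp

theorem boundedIntoHInfty_of_eq_const {c : ℂ} (hc : ∀ z ∈ unitDisc, g z = c) :
    BoundedIntoHInfty cauchyAC cauchyNorm (integralOp g) := by
  have hderiv : ∀ z ∈ unitDisc, deriv g z = 0 := fun z hz => by
    have : g =ᶠ[nhds z] fun _ => c := Filter.eventually_of_mem (isOpen_unitDisc.mem_nhds hz) hc
    rw [this.deriv_eq, deriv_const]
  have hzero : ∀ f : ℂ → ℂ, EqOn (integralOp g f) (fun _ => 0) unitDisc := by
    intro f z hz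
    have : ∫ t in (0 : ℝ)..1, f (t * z) * deriv g (t * z) = ∫ _ in (0 : ℝ)..1, (0 : ℂ) := by
      refine intervalIntegral.integral_congr fun t ht => ?_
      rw [uIcc_of_le zero_le_one] at ht
      rw [hderiv _ (real_mul_mem_unitDisc ht hz), mul_zero]
    rw [integralOp, this]
    simp
  have hnorm : ∀ f : ℂ → ℂ, hInftyNorm (integralOp g f) = 0 := by
    intro f
    refine le_antisymm (iSup₂_le fun z hz => ?_) zero_le
    rw [hzero f hz]
    simp
  refine ⟨0, fun f _ => ⟨⟨(differentiableOn_const 0).congr (hzero f), ?_⟩, ?_⟩⟩ <;> simp [hnorm]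

end MainTheorem

theorem mainTheorem2 (g : ℂ → ℂ) (hg : g ∈ analyticDisc) :
    [BoundedIntoHInfty hInfty hInftyNorm (integralOp g),
      BoundedIntoHInfty discAlgebra hInftyNorm (integralOp g),
      (⨆ z ∈ unitDisc, cauchyNorm (kernelG g z)) < ∞].TFAE ∧
    (BoundedIntoHInfty cauchyAC cauchyNorm (integralOp g) ↔
      ∃ c : ℂ, ∀ z ∈ unitDisc, g z = c) := by
  refine ⟨?_, exists_eq_const_of_boundedIntoHInfty hg, fun ⟨c, hc⟩ =>
    boundedIntoHInfty_of_eq_const hc⟩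
  tfae_have 1 → 2 := fun ⟨C, hC⟩ => ⟨C, fun f hf => hC f (discAlgebra_subset_hInfty hf)⟩
  tfae_have 2 → 3 := iSup_cauchyNorm_lt_top_of_boundedIntoHInfty hg
  tfae_have 3 → 1 := boundedIntoHInfty_of_iSup_cauchyNorm_lt_top hg
  tfae_finish
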